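/- **Setting.** All logarithms are to base 2. For $n$ qubits let $\mathcal P_n=\mathbb Z_2^n\times\mathbb Z_2^n$, with points $u=(u_x,u_z)$ and $[u,v]=u_z\cdot v_x+v_z\cdot u_x$, let $D_u=Z(u_z)X(u_x)$, $A_u=2^{-n}\sum_v(-1)^{[u,v]}D_v$ and $W_M(u)=2^{-n}\operatorname{tr}[A_u^\dagger M]$. An $n$-rebit state is a density matrix of $n$ qubits with real entries in the computational basis; its $W$ is real and sums to $1$. Let $\mathcal A=\{2a/(2b-1): a,b\in\mathbb N,\ a\ge b\ge 1\}\cup\{\infty\}$. For real $w$, nonnegative $r$ and finite $\alpha\in\mathcal A$ put $D_\alpha(w\|r)=\frac1{\alpha-1}\log\sum_i w_i^\alpha r_i^{1-\alpha}$ and $H_\alpha(w)=\frac1{1-\alpha}\log\sum_i w_i^\alpha$, where $w_i^\alpha=|w_i|^\alpha$; further $D_\infty(w\|r)=\log\max_i|w_i|/r_i$ and $H_\infty(w)=-\log\max_i|w_i|$. Indices with $w_i=r_i=0$ contribute $0$, and an index with $w_i\neq0=r_i$ makes $D_\alpha=\infty$. CSS observables are the operators $\pm X(a)$, $\pm Z(a)$.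 An $[[n,k]]$ CSS code is the joint $+1$ eigenspace of $n-k$ independent commuting CSS observables that generate a group not containing $-1$. For $k=0$ it is spanned by one vector, a pure CSS state; CSS states are the convex combinations of pure CSS states. A unitary is completely CSS-preserving if, applied to some of the qubits of a CSS state on any larger system, it always yields a CSS state. An $n$-to-$k$ CSS code projection is a map $\mathcal K(M)=\operatorname{tr}_{k+1,\dots,n}[VPMPV^\dagger]$, where $P$ is the projector onto an $[[n,k]]$ CSS code and $V$ is a completely CSS-preserving decoding unitary, i.e. $VPV^\dagger=\mathbb 1^{\otimes k}\otimes\omega$ for some $\omega$ on the last $n-k$ qubits. It distils $\rho'$ from $n$ copies of $\rho$ with acceptance probability $p$ if $\mathcal K(\rho^{\otimes n})=p\rho'$. **Theorem.** Let $\rho$ be a one-rebit state, $\rho'$ a $k$-rebit state, $p\in(0,1]$, $\sigma$ a CSS state on $k$ qubits and $\alpha\in\mathcal A$. For real $n\ge k$ put $$\rho_p=p\,\rho'\otimes|0\rangle\langle0|+(1-p)\,\sigma\otimes|1\rangle\langle1|,\qquad \tau_{n,k}=2^{k-n}\,\frac{\mathbb 1^{\otimes k}}{2^k}\otimes|0\rangle\langle0|+(1-2^{k-n})\,\sigma\otimes|1\rangle\langle1|,$$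 $$\Delta D_\alpha(n)=n\,D_\alpha(W_\rho\|W_{\mathbb 1/2})-D_\alpha(W_{\rho_p}\|W_{\tau_{n,k}})\in[-\infty,\infty),$$ and let $n_L^\alpha$ and $n_U^\alpha$ be the infimum and the supremum of $\{n\in[k,\infty):\Delta D_\alpha(n)\ge0\}$, with $n_L^\alpha=\infty$ and $n_U^\alpha=-\infty$ if this set is empty. Then: 1. If some $n$-to-$k$ CSS code projection distils $\rho'$ from $n$ copies of $\rho$ with acceptance probability $p$, then $n_L^\alpha\le n\le n_U^\alpha$. 2. If $H_\alpha(W_\rho)>1$, then $n_U^\alpha<\infty$. 3. $\Delta D_\alpha$ is concave on $[k,\infty)$; if $p<1$, then $\Delta D_\alpha(n)\to-\infty$ as $n\to k^+$; and if $H_\alpha(W_\rho)>1$, then $\Delta D_\alpha(n)\to-\infty$ as $n\to\infty$. -/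

import Mathlib

open scoped ENNReal ComplexOrder
open Filter Topology

namespace CSSMagic

noncomputable section

/-! ### Qubits, Pauli operators and phase space -/

/-- Binary vectors of length `n`; they also label the computational basis of `n` qubits. -/
abbrev Bits (n : ℕ) := Fin n → ZMod 2

/-- Operators on `n` qubits, as matrices in the computational basis. -/
abbrev Op (n : ℕ) := Matrix (Bits n) (Bits n) ℂ

/-- `(-1)^x` for a bit `x`. -/
def sgn (x : ZMod 2) : ℂ := (-1) ^ x.val

/-- `X(a) = X^{a_1} ⊗ ⋯ ⊗ X^{a_n}`, that is `X(a)|g⟩ = |g + a⟩`. -/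
def pauliX {n : ℕ} (a : Bits n) : Op n := fun f g => if f = g + a then 1 else 0

/-- `Z(a) = Z^{a_1} ⊗ ⋯ ⊗ Z^{a_n}`, that is `Z(a)|g⟩ = (-1)^{a·g}|g⟩`. -/
def pauliZ {n : ℕ} (a : Bits n) : Op n := Matrix.diagonal fun g => sgn (a ⬝ᵥ g)

/-- The phase space `ℤ₂ⁿ × ℤ₂ⁿ` with points `u = (u_x, u_z)`. -/
abbrev Phase (n : ℕ) := Bits n × Bits n

/-- The symplectic product `[u, v] = u_z · v_x + v_z · u_x` (mod 2). -/
def symp {n : ℕ} (u v : Phase n) : ZMod 2 := u.2 ⬝ᵥ v.1 + v.2 ⬝ᵥ u.1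

/-- Displacement operators `D_u = Z(u_z) X(u_x)`. -/
def disp {n : ℕ} (u : Phase n) : Op n := pauliZ u.2 * pauliX u.1

/-- Phase point operators `A_u = 2⁻ⁿ ∑_v (-1)^{[u,v]} D_v`. -/
def phasePoint {n : ℕ} (u : Phase n) : Op n :=
  ((2 : ℂ) ^ n)⁻¹ • ∑ v : Phase n, sgn (symp u v) • disp v

/-- The (complex) Wigner representation `2⁻ⁿ tr[A_u† M]`. -/
def wignerC {n : ℕ} (M : Op n) (u : Phase n) : ℂ :=
  ((2 : ℂ) ^ n)⁻¹ * ((phasePoint u).conjTranspose * M).trace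

/-- The Wigner representation `W_M` of an operator with real entries. It is the real part of
`wignerC M`, whose imaginary part vanishes for such operators (`wignerC_im`). -/
def wigner {n : ℕ} (M : Op n) (u : Phase n) : ℝ := (wignerC M u).re

/-- Density matrices of `n` qubits. -/
def IsState {n : ℕ} (M : Op n) : Prop := M.PosSemidef ∧ M.trace = 1

/-- `n`-rebit states: density matrices that are real in the computational basis. -/
def IsRebitState {n : ℕ} (M : Op n) : Prop := IsState M ∧ ∀ i j, (M i j).im = 0

/-! ### Tensor products and partial trace -/

/-- `M ⊗ N` on `a + b` qubits, the first `a` qubits carrying `M`. -/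
def tensor {a b : ℕ} (M : Op a) (N : Op b) : Op (a + b) := fun f g =>
  M (fun i => f (Fin.castAdd b i)) (fun i => g (Fin.castAdd b i)) *
    N (fun i => f (Fin.natAdd a i)) (fun i => g (Fin.natAdd a i))

/-- `n` copies `M^{⊗ n}` of a one-qubit operator. -/
def tensorPow (M : Op 1) (n : ℕ) : Op n := fun f g => ∏ i, M (fun _ => f i) (fun _ => g i)

/-- The partial trace over the last `m` of `k + m` qubits. -/
def traceLast {k m : ℕ} (M : Op (k + m)) : Op k := fun f g =>
  ∑ c : Bits m, M (Fin.append f c) (Fin.append g c)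

/-- The projector `|x⟩⟨x|` on one qubit. -/
def ketbra (x : ZMod 2) : Op 1 := Matrix.diagonal fun g => if g 0 = x then 1 else 0

/-- The maximally mixed state of `n` qubits. -/
def maxMixed (n : ℕ) : Op n := ((2 : ℂ) ^ n)⁻¹ • 1

/-! ### CSS observables, codes and states -/

/-- A CSS observable `± X(a)` or `± Z(a)`. -/
structure CSSObservable (n : ℕ) where
  /-- `true` for `X`-type, `false` for `Z`-type -/
  isX : Bool
  /-- the binary vector `a` -/
  vec : Bits n
  /-- the sign is `(-1)^sign` -/
  sign : ZMod 2

/-- The operator of a CSS observable. -/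
def CSSObservable.op {n : ℕ} (S : CSSObservable n) : Op n :=
  sgn S.sign • (if S.isX then pauliX S.vec else pauliZ S.vec)

/-- The phase space point of a CSS observable, which determines it up to sign. -/
def CSSObservable.point {n : ℕ} (S : CSSObservable n) : Phase n :=
  if S.isX then (S.vec, 0) else (0, S.vec)

/-- `m` commuting and independent CSS observables on `n` qubits, i.e. generators of the stabilizer
group of an `[[n, n - m]]` CSS code. Linear independence over `ℤ₂` of the underlying phase space
points says that the generators are independent (none being `± 1`) and that `-1` is not in the group
that they generate. -/
structure CSSGenerators (n m : ℕ) where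
  /-- the generators -/
  gen : Fin m → CSSObservable n
  comm : ∀ i j, (gen i).op * (gen j).op = (gen j).op * (gen i).op
  indep : LinearIndependent (ZMod 2) fun i => (gen i).point

/-- The projector `∏_i (1 + S_i)/2` onto the joint `+1` eigenspace of the generators. -/
def CSSGenerators.proj {n m : ℕ} (C : CSSGenerators n m) : Op n :=
  (List.ofFn fun i => (2 : ℂ)⁻¹ • (1 + (C.gen i).op)).prod

/-- Pure CSS states, as density matrices: the (rank one) projector `|ψ⟩⟨ψ|` onto the joint `+1`
eigenspace of `n` commuting and independent CSS observables on `n` qubits. -/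
def pureCSS (n : ℕ) : Set (Op n) := {M | ∃ C : CSSGenerators n n, M = C.proj}

/-- CSS states: the convex hull of the pure CSS states. -/
def cssStates (n : ℕ) : Set (Op n) := convexHull ℝ (pureCSS n)

/-- `V` is completely CSS-preserving: applied to the last `n` qubits of a CSS state on `a + n`
qubits, for any `a`, it yields a CSS state. -/
def CompletelyCSSPreserving {n : ℕ} (V : Op n) : Prop :=
  ∀ (a : ℕ) (M : Op (a + n)), M ∈ cssStates (a + n) →
    tensor (1 : Op a) V * M * (tensor (1 : Op a) V).conjTranspose ∈ cssStates (a + n)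

/-- The data of a code projection for an `[[n, k]]` CSS code with `n = k + m`: generators of the
stabilizer group, and a decoding unitary `V`. The latter is completely CSS-preserving and maps the
code space onto the first `k` qubits, the `m` syndrome qubits being left in some state `ω` that does
not depend on the encoded state. -/
structure CSSCodeProjection (k m : ℕ) where
  /-- the stabilizer generators of the code -/
  code : CSSGenerators (k + m) m
  /-- the decoding unitary -/
  V : Op (k + m)
  unitary : V ∈ Matrix.unitaryGroup (Bits (k + m)) ℂ
  preserving : CompletelyCSSPreserving V
  decodes : ∃ ω : Op m, V * code.proj * V.conjTranspose = tensor (1 : Op k) ω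

/-- The operation `𝒦(M) = tr_{k+1,…,n}[V (P M P) V†]`. -/
def CSSCodeProjection.apply {k m : ℕ} (K : CSSCodeProjection k m) (M : Op (k + m)) : Op k :=
  traceLast (K.V * (K.code.proj * M * K.code.proj) * K.V.conjTranspose)

/-! ### Rényi divergences and entropies -/

/-- The set `𝒜 = {2a/(2b-1) : a, b ∈ ℕ, a ≥ b ≥ 1} ∪ {∞}` of orders. -/
def orders : Set ℝ≥0∞ :=
  {α | ∃ a b : ℕ, 1 ≤ b ∧ b ≤ a ∧ α = ENNReal.ofReal (2 * (a : ℝ) / (2 * (b : ℝ) - 1))} ∪ {⊤}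

/-- The logarithm to base 2 on `[0, ∞]`. -/
def log2 (x : ℝ≥0∞) : EReal := ENNReal.log x / ((Real.log 2 : ℝ) : EReal)

/-- The `α`-Rényi divergence `D_α(w‖r) = (α-1)⁻¹ log₂ ∑_i w_i^α r_i^{1-α}` of a real vector `w` from
a nonnegative vector `r`, for `α ∈ 𝒜`. For these `α` the power `w_i^α` has an even numerator and an
odd denominator in the exponent, so that it equals `|w_i|^α` (`pow_order_eq`). For `α = ∞` this is
the limit `log₂ max_i |w_i| / r_i`. Where `r_i = 0`, the usual conventions are in force: the index
contributes `0` if `w_i = 0` and makes the divergence infinite otherwise. -/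
def renyiDiv {ι : Type} [Fintype ι] (α : ℝ≥0∞) (w r : ι → ℝ) : EReal :=
  if α = ⊤ then log2 (⨆ i, ENNReal.ofReal |w i| / ENNReal.ofReal (r i))
  else (((α.toReal - 1)⁻¹ : ℝ) : EReal) *
    log2 (∑ i, ENNReal.ofReal |w i| ^ α.toReal * ENNReal.ofReal (r i) ^ (1 - α.toReal))

/-- The `α`-Rényi entropy `H_α(w) = (1-α)⁻¹ log₂ ∑_i w_i^α`, with the limit `-log₂ max_i |w_i|` for
`α = ∞`. -/
def renyiEntropy {ι : Type} [Fintype ι] (α : ℝ≥0∞) (w : ι → ℝ) : ℝ :=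
  if α = ⊤ then - Real.logb 2 (⨆ i, |w i|)
  else (1 - α.toReal)⁻¹ * Real.logb 2 (∑ i, |w i| ^ α.toReal)

/-! ### The relative entropy difference and the code length bounds -/

/-- `ρ_p = p ρ' ⊗ |0⟩⟨0| + (1-p) σ ⊗ |1⟩⟨1|`. -/
def rhoP {k : ℕ} (p : ℝ) (ρ' σ : Op k) : Op (k + 1) :=
  (p : ℂ) • tensor ρ' (ketbra 0) + ((1 - p : ℝ) : ℂ) • tensor σ (ketbra 1)

/-- `τ_{n,k} = 2^{k-n} (1/2)^{⊗k} ⊗ |0⟩⟨0| + (1-2^{k-n}) σ ⊗ |1⟩⟨1|`, for real `n`. -/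
def tau {k : ℕ} (n : ℝ) (σ : Op k) : Op (k + 1) :=
  (((2 : ℝ) ^ ((k : ℝ) - n) : ℝ) : ℂ) • tensor (maxMixed k) (ketbra 0) +
    ((1 - (2 : ℝ) ^ ((k : ℝ) - n) : ℝ) : ℂ) • tensor σ (ketbra 1)

/-- `ΔD_α(n) = n D_α(W_ρ‖W_{1/2}) - D_α(W_{ρ_p}‖W_{τ_{n,k}})` as a function of real `n ≥ k`. -/
def deltaD {k : ℕ} (α : ℝ≥0∞) (ρ : Op 1) (ρ' : Op k) (p : ℝ) (σ : Op k) (n : ℝ) : EReal :=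
  (n : EReal) * renyiDiv α (wigner ρ) (wigner (maxMixed 1)) -
    renyiDiv α (wigner (rhoP p ρ' σ)) (wigner (tau n σ))

/-- The set `{n ∈ [k, ∞) : ΔD_α(n) ≥ 0}`, viewed in the extended reals. -/
def feasible {k : ℕ} (α : ℝ≥0∞) (ρ : Op 1) (ρ' : Op k) (p : ℝ) (σ : Op k) : Set EReal :=
  (fun n : ℝ => (n : EReal)) '' {n : ℝ | (k : ℝ) ≤ n ∧ 0 ≤ deltaD α ρ ρ' p σ n}

/-- `n_L^α`, the infimum of the `n` with `ΔD_α(n) ≥ 0` (it is `∞` if there is no such `n`). -/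
def nLower {k : ℕ} (α : ℝ≥0∞) (ρ : Op 1) (ρ' : Op k) (p : ℝ) (σ : Op k) : EReal :=
  sInf (feasible α ρ ρ' p σ)

/-- `n_U^α`, the supremum of the `n` with `ΔD_α(n) ≥ 0` (it is `-∞` if there is no such `n`). -/
def nUpper {k : ℕ} (α : ℝ≥0∞) (ρ : Op 1) (ρ' : Op k) (p : ℝ) (σ : Op k) : EReal :=
  sSup (feasible α ρ ρ' p σ)

/-! ### Two facts that justify the definitions -/

theorem sgn_im (x : ZMod 2) : (sgn x).im = 0 := by
  have h : sgn x = (((-1 : ℝ) ^ x.val : ℝ) : ℂ) := by simp [sgn]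
  rw [h, Complex.ofReal_im]

theorem phasePoint_im {n : ℕ} (u : Phase n) (i j : Bits n) : (phasePoint u i j).im = 0 := by
  have h2 : ((2 : ℂ) ^ n)⁻¹ = ((((2 : ℝ) ^ n)⁻¹ : ℝ) : ℂ) := by simp
  have hd : ∀ v : Phase n, (disp v i j).im = 0 := by
    intro v
    simp only [disp, pauliZ, Matrix.diagonal_mul, pauliX]
    split_ifs <;> simp [sgn_im]
  simp only [phasePoint, Matrix.smul_apply, Matrix.sum_apply, smul_eq_mul]
  rw [h2, Complex.im_ofReal_mul, Complex.im_sum]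
  simp [Complex.mul_im, sgn_im, hd]

/-- The Wigner representation of an operator with real entries is real. -/
theorem wignerC_im {n : ℕ} (M : Op n) (hM : ∀ i j, (M i j).im = 0) (u : Phase n) :
    (wignerC M u).im = 0 := by
  have h2 : ((2 : ℂ) ^ n)⁻¹ = ((((2 : ℝ) ^ n)⁻¹ : ℝ) : ℂ) := by simp
  simp only [wignerC, Matrix.trace, Matrix.diag, Matrix.mul_apply]
  rw [h2, Complex.im_ofReal_mul, Complex.im_sum]
  simp [Complex.mul_im, hM, phasePoint_im]

/-- For `α = 2a/(2b-1)`, the real power `w^α`, i.e. the `2a`-th power of the real `(2b-1)`-th root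
`t` of `w`, is `|w|^α`. -/
theorem pow_order_eq (a b : ℕ) (hb : 1 ≤ b) (w t : ℝ) (ht : t ^ (2 * b - 1) = w) :
    t ^ (2 * a) = |w| ^ (2 * (a : ℝ) / (2 * (b : ℝ) - 1)) := by
  obtain ⟨c, rfl⟩ : ∃ c, b = c + 1 := ⟨b - 1, by omega⟩
  have hc : 2 * (c + 1) - 1 = 2 * c + 1 := by omega
  rw [hc] at ht
  have hpos : (2 * (c : ℝ) + 1) ≠ 0 := by positivity
  rw [← ht, abs_pow, ← Real.rpow_natCast |t|, ← Real.rpow_mul (abs_nonneg t)]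
  have : (((2 * c + 1 : ℕ) : ℝ) * (2 * (a : ℝ) / (2 * ((c + 1 : ℕ) : ℝ) - 1)))
      = ((2 * a : ℕ) : ℝ) := by
    push_cast
    have : (2 * ((c : ℝ) + 1) - 1) = 2 * c + 1 := by ring
    rw [this]
    field_simp
  rw [this, Real.rpow_natCast, pow_mul, pow_mul, sq_abs]

end

end CSSMagic

open CSSMagic

/-!
The phase point operator `A_{(x,z)}` has a single nonzero row (`phasePoint_apply`), so that the
Wigner representation is `W_M(x,z) = 2⁻ⁿ ∑_g (-1)^{z·(x+g)} ⟨x|M|g⟩`. It is multiplicative on tensor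
products and is marginalized by partial traces.

The central fact is that a CSS code projection acts on Wigner representations as a real matrix with
nonnegative entries and column sums at most `1` (`CSSCodeProjection.wignerSubstochastic`). Three
operations are composed. Conjugation with `(1 + S)/2` for a CSS observable `S` restricts `W` to half
of the phase space and averages it over a translation, because the point of `S` has only an
`x`-component or only a `z`-component; a code projector is a commuting product of such factors. The
matrix of a decoding unitary `V` is, up to a factor, the Wigner representation of the Choi state
`(1 ⊗ V)|Φ⟩⟨Φ|(1 ⊗ V)†`. The maximally entangled state `Φ` is a CSS state (`bell_proj_apply`), so
complete CSS preservation makes the Choi state a CSS state, and CSS states have nonnegative Wigner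
representations (`cssStates_subset`). The partial trace is a marginal.

If the failing branch is completed with the missing column sums, one obtains a stochastic matrix that
sends `(W_ρ^{⊗n}, W_{1/2}^{⊗n})` to the flagged pair `(W_{ρ_p}, W_{τ_{n,k}})`
(`CSSCodeProjection.exists_stochastic`); that the maximally mixed state goes to `τ_{n,k}` is the
dimension count `tr P = 2^k`. Jensen's inequality (`abs_sum_rpow_mul_rpow_le`) shows that the Rényi
sums `∑ |w|^α r^{1-α}` do not increase, although `w` may be negative. Hence `ΔD_α(n) ≥ 0` for every
code length `n` at which distillation is possible.

For the shape of `ΔD_α`, the divergence of `ρ_p` from `τ_{n,k}` is computed in closed form: it is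
`e⁻¹ log₂ φ(A 2^{en}, B (1-2^{k-n})^{-e})`, with `φ = +` and `e = α - 1` for finite `α`, and `φ = max`
and `e = 1` for `α = ∞` (`exists_flaggedDiv`). Both arguments of `φ` are log-convex in `n`, and Hölder's
inequality makes `φ` of them log-convex. The first argument bounds the divergence below by `n` plus a
constant, against the slope `2 - H_α(W_ρ)` of the first term of `ΔD_α`; the second one, for `p < 1`,
makes it tend to infinity at `n = k`.
-/

namespace CSSMagic

/-! ### Signs and character sums over `ℤ₂ⁿ` -/

@[simp] theorem sgn_zero : sgn 0 = 1 := by simp [sgn]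

@[simp] theorem sgn_one : sgn 1 = -1 := by simp [sgn, ZMod.val_one]

theorem zmod_two_cases (x : ZMod 2) : x = 0 ∨ x = 1 := by
  revert x
  decide

theorem sgn_add (x y : ZMod 2) : sgn (x + y) = sgn x * sgn y := by
  have h : (1 + 1 : ZMod 2) = 0 := by decide
  rcases zmod_two_cases x with rfl | rfl <;> rcases zmod_two_cases y with rfl | rfl <;> simp [h]

@[simp] theorem sgn_mul_self (x : ZMod 2) : sgn x * sgn x = 1 := by
  rcases zmod_two_cases x with rfl | rfl <;> simp

@[simp] theorem star_sgn (x : ZMod 2) : star (sgn x) = sgn x := by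
  rcases zmod_two_cases x with rfl | rfl <;> simp

@[simp] theorem bits_add_self {n : ℕ} (a : Bits n) : a + a = 0 := by
  ext i
  exact CharTwo.add_self_eq_zero (a i)

@[simp] theorem bits_add_cancel_right {n : ℕ} (g a : Bits n) : g + a + a = g := by
  rw [add_assoc, bits_add_self, add_zero]

theorem bits_add_eq_iff {n : ℕ} (f g a : Bits n) : f = g + a ↔ g = f + a :=
  ⟨fun h => by rw [h, bits_add_cancel_right], fun h => by rw [h, bits_add_cancel_right]⟩

theorem bits_add_eq_zero_iff {n : ℕ} (f g : Bits n) : f + g = 0 ↔ g = f := by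
  refine ⟨fun h => ?_, fun h => by rw [h, bits_add_self]⟩
  have h2 := bits_add_cancel_right f g
  rw [h, zero_add] at h2
  exact h2

theorem card_bits (n : ℕ) : Fintype.card (Bits n) = 2 ^ n := by
  simp [ZMod.card]

theorem card_phase (n : ℕ) : Fintype.card (Phase n) = 4 ^ n := by
  rw [Fintype.card_prod, card_bits, ← mul_pow]
  norm_num

/-- Orthogonality of the characters of `ℤ₂ⁿ`. -/
theorem sum_sgn_dot {n : ℕ} (a : Bits n) :
    ∑ z : Bits n, sgn (z ⬝ᵥ a) = if a = 0 then (2 : ℂ) ^ n else 0 := by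
  split_ifs with h
  · subst h
    simp
  · obtain ⟨i, hi⟩ := Function.ne_iff.1 h
    have hi1 : a i = 1 := (zmod_two_cases (a i)).resolve_left hi
    -- translation by the `i`-th unit vector flips the sign of every summand
    have key : ∑ z : Bits n, sgn (z ⬝ᵥ a) = ∑ z : Bits n, -sgn (z ⬝ᵥ a) := by
      refine (Equiv.sum_comp (Equiv.addRight (Pi.single i 1 : Bits n)) _).symm.trans ?_
      refine Finset.sum_congr rfl fun z _ => ?_
      simp [add_dotProduct, sgn_add, hi1]
    rw [Finset.sum_neg_distrib] at key
    linear_combination (1 / 2) * key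

/-! ### Explicit formulas for the Wigner representation -/

/-- The phase point operator `A_{(x,z)}` has a single nonzero row, the row `x`. -/
theorem phasePoint_apply {n : ℕ} (u : Phase n) (f g : Bits n) :
    phasePoint u f g = if f = u.1 then sgn (u.2 ⬝ᵥ (u.1 + g)) else 0 := by
  have h1 : ∀ v : Phase n, sgn (symp u v) • disp v f g =
      if f = g + v.1 then sgn (u.2 ⬝ᵥ v.1) * sgn (v.2 ⬝ᵥ (u.1 + f)) else 0 := by
    intro v
    simp only [disp, pauliZ, Matrix.diagonal_mul, pauliX, symp, smul_eq_mul, sgn_add,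
      dotProduct_add]
    split_ifs
    · ring
    · ring
  simp only [phasePoint, Matrix.smul_apply, Matrix.sum_apply, h1]
  have h2 : ∀ x z : Bits n, (if f = g + x then sgn (u.2 ⬝ᵥ x) * sgn (z ⬝ᵥ (u.1 + f)) else 0)
      = if x = f + g then sgn (u.2 ⬝ᵥ x) * sgn (z ⬝ᵥ (u.1 + f)) else 0 := by
    intro x z
    refine if_congr ?_ rfl rfl
    rw [add_comm g x, bits_add_eq_iff]
  rw [Fintype.sum_prod_type]
  simp only [h2]
  rw [Finset.sum_comm]
  simp only [Finset.sum_ite_eq', Finset.mem_univ, if_true]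
  rw [← Finset.mul_sum, sum_sgn_dot]
  simp only [bits_add_eq_zero_iff]
  split_ifs with h
  · rw [h, smul_eq_mul]
    field_simp
  · simp

theorem wignerC_apply {n : ℕ} (M : Op n) (u : Phase n) :
    wignerC M u = ((2 : ℂ) ^ n)⁻¹ * ∑ g, sgn (u.2 ⬝ᵥ (u.1 + g)) * M u.1 g := by
  unfold wignerC
  congr 1
  simp only [Matrix.trace, Matrix.diag, Matrix.mul_apply, Matrix.conjTranspose_apply,
    phasePoint_apply]
  refine Finset.sum_congr rfl fun g _ => ?_
  rw [Finset.sum_eq_single u.1]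
  · simp
  · intro f _ hf
    simp [hf]
  · simp

theorem wignerC_add {n : ℕ} (M N : Op n) (u : Phase n) :
    wignerC (M + N) u = wignerC M u + wignerC N u := by
  simp [wignerC, mul_add]

theorem wignerC_smul {n : ℕ} (c : ℂ) (M : Op n) (u : Phase n) :
    wignerC (c • M) u = c * wignerC M u := by
  simp only [wignerC, Matrix.mul_smul, Matrix.trace_smul, smul_eq_mul]
  ring

theorem wignerC_sum {n : ℕ} {ι : Type*} (s : Finset ι) (M : ι → Op n) (u : Phase n) :
    wignerC (∑ i ∈ s, M i) u = ∑ i ∈ s, wignerC (M i) u := by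
  simp [wignerC, Matrix.trace_sum, Finset.mul_sum]

/-- The phase point operators are a basis, dual to the Wigner representation. -/
theorem sum_wignerC_smul_phasePoint {n : ℕ} (M : Op n) :
    ∑ u, wignerC M u • phasePoint u = M := by
  ext f g
  simp only [Matrix.sum_apply, Matrix.smul_apply, phasePoint_apply, wignerC_apply, smul_eq_mul]
  rw [Fintype.sum_prod_type, Finset.sum_eq_single f]
  · simp only [if_true]
    have h : ∀ z : Bits n,
        ((2 : ℂ) ^ n)⁻¹ * (∑ h, sgn (z ⬝ᵥ (f + h)) * M f h) * sgn (z ⬝ᵥ (f + g))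
        = ∑ h, ((2 : ℂ) ^ n)⁻¹ * M f h * sgn (z ⬝ᵥ (h + g)) := by
      intro z
      rw [Finset.mul_sum, Finset.sum_mul]
      refine Finset.sum_congr rfl fun h _ => ?_
      have : h + g = (f + h) + (f + g) := by
        rw [add_comm f h, add_assoc, ← add_assoc f f g, bits_add_self, zero_add]
      rw [this, dotProduct_add z (f + h), sgn_add (z ⬝ᵥ (f + h))]
      ring
    simp only [h]
    rw [Finset.sum_comm]
    simp only [← Finset.mul_sum, sum_sgn_dot, bits_add_eq_zero_iff]
    rw [Finset.sum_eq_single g]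
    · simp only [if_true]
      field_simp
    · intro h _ hh
      simp [Ne.symm hh]
    · simp
  · intro x _ hx
    simp [Ne.symm hx]
  · simp

theorem sum_wignerC {n : ℕ} (M : Op n) : ∑ u, wignerC M u = M.trace := by
  simp only [wignerC_apply]
  rw [Fintype.sum_prod_type]
  refine Finset.sum_congr rfl fun f _ => ?_
  dsimp only
  rw [← Finset.mul_sum, Finset.sum_comm]
  simp only [← Finset.sum_mul, sum_sgn_dot, bits_add_eq_zero_iff]
  simp

theorem wignerC_one {n : ℕ} (u : Phase n) : wignerC (1 : Op n) u = ((2 : ℂ) ^ n)⁻¹ := by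
  rw [wignerC_apply, Finset.sum_eq_single u.1]
  · simp
  · intro g _ hg
    simp [Matrix.one_apply_ne (Ne.symm hg)]
  · simp

theorem wignerC_maxMixed (n : ℕ) (u : Phase n) : wignerC (maxMixed n) u = ((4 : ℂ) ^ n)⁻¹ := by
  rw [maxMixed, wignerC_smul, wignerC_one, ← mul_inv, ← mul_pow]
  norm_num

/-- Sums over the bit strings of a bipartite system. -/
theorem sum_bits_append {a b : ℕ} {R : Type*} [AddCommMonoid R] (F : Bits (a + b) → R) :
    ∑ f, F f = ∑ f₁ : Bits a, ∑ f₂ : Bits b, F (Fin.append f₁ f₂) := by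
  rw [← Fintype.sum_prod_type', ← Equiv.sum_comp (Fin.appendEquiv a b)]
  rfl

theorem append_dotProduct_append {a b : ℕ} (f₁ g₁ : Bits a) (f₂ g₂ : Bits b) :
    Fin.append f₁ f₂ ⬝ᵥ Fin.append g₁ g₂ = f₁ ⬝ᵥ g₁ + f₂ ⬝ᵥ g₂ := by
  simp [dotProduct, Fin.sum_univ_add]

theorem append_add_append {a b : ℕ} (f₁ g₁ : Bits a) (f₂ g₂ : Bits b) :
    Fin.append f₁ f₂ + Fin.append g₁ g₂ = Fin.append (f₁ + g₁) (f₂ + g₂) := by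
  ext i
  refine Fin.addCases (fun i => ?_) (fun i => ?_) i <;> simp

/-- The pair of phase space points `u` and `v`, as a point of the phase space of the bipartite
system. -/
def phaseAppend {a b : ℕ} (u : Phase a) (v : Phase b) : Phase (a + b) :=
  (Fin.append u.1 v.1, Fin.append u.2 v.2)

/-- The decomposition of the phase space of a bipartite system. -/
def phaseEquiv (a b : ℕ) : Phase a × Phase b ≃ Phase (a + b) :=
  (Equiv.prodProdProdComm _ _ _ _).trans ((Fin.appendEquiv a b).prodCongr (Fin.appendEquiv a b))

theorem phaseEquiv_apply {a b : ℕ} (w : Phase a × Phase b) :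
    phaseEquiv a b w = phaseAppend w.1 w.2 := rfl

theorem sum_phaseAppend {a b : ℕ} {R : Type*} [AddCommMonoid R] (F : Phase (a + b) → R) :
    ∑ u, F u = ∑ v : Phase a, ∑ w : Phase b, F (phaseAppend v w) := by
  rw [← Fintype.sum_prod_type', ← Equiv.sum_comp (phaseEquiv a b)]
  rfl

theorem wignerC_phaseAppend {a b : ℕ} (M : Op (a + b)) (u : Phase a) (v : Phase b) :
    wignerC M (phaseAppend u v) = ((2 : ℂ) ^ a)⁻¹ * ((2 : ℂ) ^ b)⁻¹ *
      ∑ g₁ : Bits a, ∑ g₂ : Bits b, sgn (u.2 ⬝ᵥ (u.1 + g₁)) * sgn (v.2 ⬝ᵥ (v.1 + g₂)) *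
        M (Fin.append u.1 v.1) (Fin.append g₁ g₂) := by
  rw [wignerC_apply, sum_bits_append, pow_add, mul_inv]
  simp only [phaseAppend, append_add_append, append_dotProduct_append, sgn_add]

theorem tensor_append {a b : ℕ} (M : Op a) (N : Op b) (f₁ g₁ : Bits a) (f₂ g₂ : Bits b) :
    tensor M N (Fin.append f₁ f₂) (Fin.append g₁ g₂) = M f₁ g₁ * N f₂ g₂ := by
  simp [tensor]

theorem wignerC_tensor {a b : ℕ} (M : Op a) (N : Op b) (u : Phase a) (v : Phase b) :
    wignerC (tensor M N) (phaseAppend u v) = wignerC M u * wignerC N v := by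
  rw [wignerC_phaseAppend, wignerC_apply, wignerC_apply]
  simp only [tensor_append]
  rw [mul_mul_mul_comm, Finset.sum_mul_sum]
  congr 1
  refine Finset.sum_congr rfl fun _ _ => Finset.sum_congr rfl fun _ _ => ?_
  ring

theorem wignerC_tensorPow (M : Op 1) (n : ℕ) (u : Phase n) :
    wignerC (tensorPow M n) u = ∏ i, wignerC M (fun _ => u.1 i, fun _ => u.2 i) := by
  have h : ∀ i, wignerC M (fun _ => u.1 i, fun _ => u.2 i)
      = 2⁻¹ * ∑ y : ZMod 2, sgn (u.2 i * (u.1 i + y)) * M (fun _ => u.1 i) (fun _ => y) := by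
    intro i
    rw [wignerC_apply, ← Equiv.sum_comp (Equiv.funUnique (Fin 1) (ZMod 2)).symm]
    simp [dotProduct]
    rfl
  have hs : ∀ (s : Finset (Fin n)) (x : Fin n → ZMod 2),
      sgn (∑ i ∈ s, x i) = ∏ i ∈ s, sgn (x i) := by
    intro s x
    classical
    induction s using Finset.induction_on with
    | empty => simp
    | insert i s hi ih => rw [Finset.sum_insert hi, Finset.prod_insert hi, sgn_add, ih]
  simp only [h]
  rw [wignerC_apply, Finset.prod_mul_distrib, Finset.prod_univ_sum, Fintype.piFinset_univ]
  congr 1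
  · simp
  · refine Finset.sum_congr rfl fun g _ => ?_
    rw [Finset.prod_mul_distrib, dotProduct, hs]
    rfl

/-! ### Displacement operators and CSS observables -/

theorem disp_apply {n : ℕ} (u : Phase n) (f g : Bits n) :
    disp u f g = if f = g + u.1 then sgn (u.2 ⬝ᵥ f) else 0 := by
  simp [disp, pauliZ, pauliX, Matrix.diagonal_mul]

theorem disp_mul_apply {n : ℕ} (u : Phase n) (M : Op n) (f g : Bits n) :
    (disp u * M) f g = sgn (u.2 ⬝ᵥ f) * M (f + u.1) g := by
  rw [Matrix.mul_apply, Finset.sum_eq_single (f + u.1)]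
  · simp [disp_apply]
  · intro h _ hh
    rw [disp_apply, if_neg, zero_mul]
    rwa [bits_add_eq_iff]
  · simp

theorem mul_disp_apply {n : ℕ} (u : Phase n) (M : Op n) (f g : Bits n) :
    (M * disp u) f g = M f (g + u.1) * sgn (u.2 ⬝ᵥ (g + u.1)) := by
  rw [Matrix.mul_apply, Finset.sum_eq_single (g + u.1)]
  · simp [disp_apply]
  · intro h _ hh
    rw [disp_apply, if_neg hh, mul_zero]
  · simp

@[simp] theorem disp_zero {n : ℕ} : disp (0 : Phase n) = 1 := by
  ext f g
  simp [disp_apply, Matrix.one_apply]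

theorem disp_mul_disp {n : ℕ} (u v : Phase n) :
    disp u * disp v = sgn (v.2 ⬝ᵥ u.1) • disp (u + v) := by
  ext f g
  rw [disp_mul_apply, disp_apply, Matrix.smul_apply, disp_apply]
  have h : f + u.1 = g + v.1 ↔ f = g + (u + v).1 := by
    rw [eq_comm, bits_add_eq_iff, Prod.fst_add, add_assoc, add_comm v.1]
  simp only [h]
  split_ifs
  · simp only [Prod.snd_add, add_dotProduct, dotProduct_add, sgn_add, smul_eq_mul]
    ring
  · simp

theorem trace_disp {n : ℕ} (u : Phase n) :
    (disp u).trace = if u = 0 then (2 : ℂ) ^ n else 0 := by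
  simp only [Matrix.trace, Matrix.diag, disp_apply, left_eq_add]
  by_cases h : u.1 = 0
  · simp only [h, if_true, dotProduct_comm u.2, sum_sgn_dot]
    refine if_congr ?_ rfl rfl
    rw [Prod.ext_iff]
    simp [h]
  · simp only [h, if_false, Finset.sum_const_zero]
    rw [if_neg]
    rintro rfl
    exact h rfl

theorem pauliX_eq_disp {n : ℕ} (a : Bits n) : pauliX a = disp (a, 0) := by
  ext f g
  simp [disp_apply, pauliX]

theorem pauliZ_eq_disp {n : ℕ} (a : Bits n) : pauliZ a = disp (0, a) := by
  ext f g
  simp [disp_apply, pauliZ, Matrix.diagonal_apply]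

theorem CSSObservable.op_eq {n : ℕ} (S : CSSObservable n) : S.op = sgn S.sign • disp S.point := by
  unfold CSSObservable.op CSSObservable.point
  congr 1
  cases S.isX <;> simp [pauliX_eq_disp, pauliZ_eq_disp]

theorem CSSObservable.point_cases {n : ℕ} (S : CSSObservable n) :
    S.point.1 = 0 ∨ S.point.2 = 0 := by
  unfold CSSObservable.point
  cases S.isX <;> simp

theorem CSSObservable.op_mul_self {n : ℕ} (S : CSSObservable n) : S.op * S.op = 1 := by
  have h0 : S.point.2 ⬝ᵥ S.point.1 = 0 := by
    rcases S.point_cases with h | h <;> simp [h]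
  have h1 : S.point + S.point = 0 := Prod.ext (bits_add_self _) (bits_add_self _)
  rw [op_eq, Matrix.smul_mul, Matrix.mul_smul, disp_mul_disp, h0, h1, smul_smul]
  simp

/-- The projector `(1 + S)/2` onto the `+1` eigenspace of a CSS observable. -/
noncomputable def CSSObservable.proj {n : ℕ} (S : CSSObservable n) : Op n := (2 : ℂ)⁻¹ • (1 + S.op)

theorem CSSObservable.op_mul_proj {n : ℕ} (S : CSSObservable n) : S.op * S.proj = S.proj := by
  rw [proj, Matrix.mul_smul, mul_add, op_mul_self, mul_one, add_comm]

theorem CSSObservable.proj_mul_op {n : ℕ} (S : CSSObservable n) : S.proj * S.op = S.proj := by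
  rw [proj, Matrix.smul_mul, add_mul, op_mul_self, one_mul, add_comm]

/-- Multiplication by a displacement operator on one side translates only the `x`-component (on the
left) or only the `z`-component (on the right) of the argument. -/
theorem wignerC_disp_mul {n : ℕ} (s : Phase n) (M : Op n) (u : Phase n) :
    wignerC (disp s * M) u = sgn (symp u s) * wignerC M (u + (s.1, 0)) := by
  simp only [wignerC_apply, disp_mul_apply, symp, Prod.fst_add, Prod.snd_add, add_zero]
  rw [mul_left_comm]
  congr 1
  rw [Finset.mul_sum]
  refine Finset.sum_congr rfl fun g _ => ?_
  have h : u.1 + s.1 + g = (u.1 + g) + s.1 := by abel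
  rw [h, dotProduct_add u.2 _ s.1, sgn_add, sgn_add]
  linear_combination (-sgn (s.2 ⬝ᵥ u.1) * sgn (u.2 ⬝ᵥ (u.1 + g)) * M (u.1 + s.1) g) *
    sgn_mul_self (u.2 ⬝ᵥ s.1)

theorem wignerC_mul_disp {n : ℕ} (s : Phase n) (M : Op n) (u : Phase n) :
    wignerC (M * disp s) u = sgn (symp u s) * wignerC M (u + (0, s.2)) := by
  simp only [wignerC_apply, mul_disp_apply, symp, Prod.fst_add, Prod.snd_add, add_zero]
  rw [mul_left_comm]
  congr 1
  rw [Finset.mul_sum, ← Equiv.sum_comp (Equiv.addRight s.1)]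
  refine Finset.sum_congr rfl fun g _ => ?_
  simp only [Equiv.coe_addRight, bits_add_cancel_right]
  have h : s.2 ⬝ᵥ g = s.2 ⬝ᵥ u.1 + s.2 ⬝ᵥ (u.1 + g) := by
    rw [← dotProduct_add, ← add_assoc, bits_add_self, zero_add]
  rw [← add_assoc, dotProduct_add u.2 _ s.1, h, add_dotProduct]
  simp only [sgn_add]
  ring

/-! ### Operations that are substochastic in the Wigner representation -/

/-- An operation that acts on Wigner representations as a real matrix with nonnegative entries and
column sums at most `1`. -/
def WignerSubstochastic {a b : ℕ} (E : Op a → Op b) : Prop :=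
  ∃ T : Phase b → Phase a → ℝ, (∀ v u, 0 ≤ T v u) ∧ (∀ u, ∑ v, T v u ≤ 1) ∧
    ∀ M v, wignerC (E M) v = ∑ u, (T v u : ℂ) * wignerC M u

theorem WignerSubstochastic.id {a : ℕ} : WignerSubstochastic (fun M : Op a => M) :=
  ⟨fun v u => if v = u then 1 else 0, fun v u => by dsimp only; split_ifs <;> simp,
    fun u => by simp, fun M v => by simp [apply_ite (Complex.ofReal)]⟩

theorem WignerSubstochastic.comp {a b c : ℕ} {F : Op b → Op c} {E : Op a → Op b}
    (hF : WignerSubstochastic F) (hE : WignerSubstochastic E) :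
    WignerSubstochastic (fun M => F (E M)) := by
  obtain ⟨S, hS0, hS1, hS⟩ := hF
  obtain ⟨T, hT0, hT1, hT⟩ := hE
  refine ⟨fun w u => ∑ v, S w v * T v u,
    fun w u => Finset.sum_nonneg fun v _ => mul_nonneg (hS0 w v) (hT0 v u), fun u => ?_,
    fun M w => ?_⟩
  · rw [Finset.sum_comm]
    refine le_trans (Finset.sum_le_sum fun v _ => ?_) (hT1 u)
    rw [← Finset.sum_mul]
    exact mul_le_of_le_one_left (hT0 v u) (hS1 v)
  · rw [hS]
    simp only [hT, Finset.mul_sum]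
    rw [Finset.sum_comm]
    refine Finset.sum_congr rfl fun u _ => ?_
    push_cast
    rw [Finset.sum_mul]
    refine Finset.sum_congr rfl fun v _ => ?_
    ring

/-- Measuring a CSS observable `S` and keeping the outcome `+1` restricts the Wigner representation
to half of the phase space and averages it over the translation by the point of `S`. -/
theorem CSSObservable.wignerC_proj_mul_mul_proj {n : ℕ} (S : CSSObservable n) (M : Op n)
    (u : Phase n) : wignerC (S.proj * M * S.proj) u =
      if symp u S.point = S.sign then 2⁻¹ * (wignerC M u + wignerC M (u + S.point)) else 0 := by
  have hz : S.point.2 ⬝ᵥ S.point.1 = 0 := by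
    rcases S.point_cases with h | h <;> simp [h]
  have e1 : u + (S.point.1, 0) + (0, S.point.2) = u + S.point := by
    rw [add_assoc]
    simp
  have e3 : symp (u + (S.point.1, 0)) S.point = symp u S.point := by
    simp [symp, dotProduct_add, hz]
  have hexp : S.proj * M * S.proj = (4 : ℂ)⁻¹ • (M + S.op * M + M * S.op + S.op * (M * S.op)) := by
    simp only [proj, Matrix.smul_mul, Matrix.mul_smul, add_mul, mul_add, one_mul, mul_one,
      mul_assoc]
    module
  rw [hexp]
  simp only [op_eq, Matrix.smul_mul, Matrix.mul_smul, wignerC_smul, wignerC_add, wignerC_disp_mul,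
    wignerC_mul_disp, e1, e3]
  have hs : ∀ t : ℂ, sgn S.sign * (sgn S.sign * t) = t := fun t => by
    rw [← mul_assoc, sgn_mul_self, one_mul]
  have hs' : ∀ t : ℂ, sgn (symp u S.point) * (sgn (symp u S.point) * t) = t := fun t => by
    rw [← mul_assoc, sgn_mul_self, one_mul]
  -- the point of a CSS observable has only an `x`-component or only a `z`-component
  have hor : (u + (S.point.1, 0) = u ∧ u + (0, S.point.2) = u + S.point) ∨
      (u + (S.point.1, 0) = u + S.point ∧ u + (0, S.point.2) = u) := by
    rcases S.point_cases with h | h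
    · left
      constructor <;> ext <;> simp [h]
    · right
      constructor <;> ext <;> simp [h]
  rw [hs, hs']
  split_ifs with h
  · rw [h]
    rcases hor with ⟨h1, h2⟩ | ⟨h1, h2⟩ <;> rw [h1, h2, hs, hs] <;> ring
  · have h' : sgn S.sign * sgn (symp u S.point) = -1 := by
      rw [← sgn_add]
      rcases zmod_two_cases S.sign with h1 | h1 <;>
        rcases zmod_two_cases (symp u S.point) with h2 | h2 <;> simp_all
    rcases hor with ⟨h1, h2⟩ | ⟨h1, h2⟩ <;> rw [h1, h2] <;>
      linear_combination (4⁻¹ * (wignerC M u + wignerC M (u + S.point))) * h'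

theorem CSSObservable.wignerSubstochastic_proj {n : ℕ} (S : CSSObservable n) :
    WignerSubstochastic (fun M => S.proj * M * S.proj) := by
  refine ⟨fun v u => if symp v S.point = S.sign then
    2⁻¹ * ((if v = u then 1 else 0) + if v = u + S.point then 1 else 0) else 0,
    fun v u => ?_, fun u => ?_, fun M v => ?_⟩
  · dsimp only
    split_ifs <;> norm_num
  · calc _ ≤ ∑ v, (2⁻¹ : ℝ) * ((if v = u then 1 else 0) + if v = u + S.point then 1 else 0) := by
          refine Finset.sum_le_sum fun v _ => ?_
          dsimp only
          split_ifs <;> norm_num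
      _ = 1 := by
          rw [← Finset.mul_sum, Finset.sum_add_distrib]
          simp
          norm_num
  · dsimp only
    rw [wignerC_proj_mul_mul_proj]
    have hv : ∀ u : Phase n, v = u + S.point ↔ v + S.point = u := by
      intro u
      have h1 : S.point + S.point = 0 := Prod.ext (bits_add_self _) (bits_add_self _)
      constructor
      · rintro rfl
        rw [add_assoc, h1, add_zero]
      · rintro rfl
        rw [add_assoc, h1, add_zero]
    split_ifs
    · simp only [hv]
      simp [mul_assoc, ← Finset.mul_sum, add_mul, Finset.sum_add_distrib,
        apply_ite (Complex.ofReal)]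
    · simp

/-! ### Projectors onto CSS codes -/

theorem CSSGenerators.commute_op_proj {n m : ℕ} (C : CSSGenerators n m) (i j : Fin m) :
    Commute (C.gen i).op (C.gen j).proj :=
  (((Commute.one_right _).add_right (C.comm i j))).smul_right _

theorem CSSGenerators.commute_proj_proj {n m : ℕ} (C : CSSGenerators n m) (i j : Fin m) :
    Commute (C.gen i).proj (C.gen j).proj :=
  ((Commute.one_left _).add_left (C.commute_op_proj i j)).smul_left _

theorem list_mul_prod_eq_prod {R : Type*} [Monoid R] {s q : R} (hsq : s * q = q) (L : List R)
    (hq : q ∈ L) (hL : ∀ x ∈ L, Commute s x) : s * L.prod = L.prod := by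
  induction L with
  | nil => simp at hq
  | cons x L ih =>
    rw [List.prod_cons]
    rcases List.mem_cons.1 hq with rfl | hq
    · rw [← mul_assoc, hsq]
    · rw [← mul_assoc, (hL x (by simp)).eq, mul_assoc,
        ih hq fun y hy => hL y (List.mem_cons_of_mem _ hy)]

theorem CSSGenerators.op_mul_proj {n m : ℕ} (C : CSSGenerators n m) (i : Fin m) :
    (C.gen i).op * C.proj = C.proj := by
  refine list_mul_prod_eq_prod (C.gen i).op_mul_proj _ ((List.mem_ofFn' _ _).2 ⟨i, rfl⟩) ?_
  intro x hx
  obtain ⟨j, rfl⟩ := (List.mem_ofFn' _ _).1 hx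
  exact C.commute_op_proj i j

theorem CSSGenerators.proj_mul_op {n m : ℕ} (C : CSSGenerators n m) (i : Fin m) :
    C.proj * (C.gen i).op = C.proj := by
  have h : Commute (C.gen i).op C.proj := by
    refine Commute.list_prod_right _ _ fun x hx => ?_
    obtain ⟨j, rfl⟩ := (List.mem_ofFn' _ _).1 hx
    exact C.commute_op_proj i j
  rw [← h.eq, C.op_mul_proj]

theorem CSSGenerators.proj_mul_self {n m : ℕ} (C : CSSGenerators n m) :
    C.proj * C.proj = C.proj := by
  have h : ∀ L : List (Op n), (∀ q ∈ L, q * C.proj = C.proj) → L.prod * C.proj = C.proj := by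
    intro L
    induction L with
    | nil => simp
    | cons x L ih =>
      intro hL
      rw [List.prod_cons, mul_assoc, ih fun q hq => hL q (List.mem_cons_of_mem _ hq),
        hL x (by simp)]
  refine h _ fun q hq => ?_
  obtain ⟨i, rfl⟩ := (List.mem_ofFn' _ _).1 hq
  change (2 : ℂ)⁻¹ • (1 + (C.gen i).op) * C.proj = C.proj
  rw [Matrix.smul_mul, add_mul, one_mul, C.op_mul_proj, ← two_smul ℂ, smul_smul]
  norm_num

theorem CSSGenerators.wignerSubstochastic_proj {n m : ℕ} (C : CSSGenerators n m) :
    WignerSubstochastic (fun M => C.proj * M * C.proj) := by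
  have h : ∀ L : List (Op n), (∀ x ∈ L, ∀ y ∈ L, Commute x y) →
      (∀ x ∈ L, WignerSubstochastic fun M => x * M * x) →
      WignerSubstochastic fun M => L.prod * M * L.prod := by
    intro L
    induction L with
    | nil =>
      intro _ _
      simpa using WignerSubstochastic.id
    | cons x L ih =>
      intro hc hp
      have hx : Commute x L.prod :=
        Commute.list_prod_right _ _ fun y hy => hc x (by simp) y (List.mem_cons_of_mem _ hy)
      have h1 := ih (fun y hy z hz => hc y (List.mem_cons_of_mem _ hy) z (List.mem_cons_of_mem _ hz))
        fun y hy => hp y (List.mem_cons_of_mem _ hy)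
      have h2 := (hp x (by simp)).comp h1
      convert h2 using 2 with M
      rw [List.prod_cons]
      nth_rewrite 2 [hx.eq]
      simp only [mul_assoc]
  refine h _ ?_ ?_
  · intro x hx y hy
    obtain ⟨i, rfl⟩ := (List.mem_ofFn' _ _).1 hx
    obtain ⟨j, rfl⟩ := (List.mem_ofFn' _ _).1 hy
    exact C.commute_proj_proj i j
  · intro x hx
    obtain ⟨i, rfl⟩ := (List.mem_ofFn' _ _).1 hx
    exact (C.gen i).wignerSubstochastic_proj

/-- A displacement outside the span of the generators has no component along the elements of the
stabilizer group. -/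
theorem trace_disp_mul_prod_proj {n m : ℕ} (gen : Fin m → CSSObservable n) (u : Phase n)
    (hu : u ∉ Submodule.span (ZMod 2) (Set.range fun i => (gen i).point)) :
    (disp u * (List.ofFn fun i => (gen i).proj).prod).trace = 0 := by
  induction m generalizing u with
  | zero =>
    have hu0 : u ≠ 0 := by
      rintro rfl
      exact hu (Submodule.zero_mem _)
    simp [trace_disp, hu0]
  | succ m ih =>
    have hmono : Submodule.span (ZMod 2) (Set.range fun i : Fin m => (gen i.succ).point) ≤
        Submodule.span (ZMod 2) (Set.range fun i => (gen i).point) :=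
      Submodule.span_mono (by rintro _ ⟨i, rfl⟩; exact ⟨i.succ, rfl⟩)
    have h0 : (gen 0).point ∈ Submodule.span (ZMod 2) (Set.range fun i => (gen i).point) :=
      Submodule.subset_span ⟨0, rfl⟩
    have h1 := ih (fun i => gen i.succ) u fun h => hu (hmono h)
    have h2 := ih (fun i => gen i.succ) (u + (gen 0).point) fun h =>
      hu ((Submodule.add_mem_iff_left _ h0).1 (hmono h))
    rw [List.ofFn_succ, List.prod_cons, ← mul_assoc]
    conv_lhs => rw [CSSObservable.proj, CSSObservable.op_eq]
    rw [Matrix.mul_smul, mul_add, mul_one, Matrix.mul_smul, disp_mul_disp, Matrix.smul_mul, add_mul,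
      Matrix.smul_mul, Matrix.smul_mul, Matrix.trace_smul, Matrix.trace_add, Matrix.trace_smul,
      Matrix.trace_smul, h1, h2]
    simp

/-- `m` independent generators on `n` qubits define a code space of dimension `2 ^ (n - m)`. -/
theorem CSSGenerators.trace_proj {n m : ℕ} (C : CSSGenerators n m) :
    2 ^ m * C.proj.trace = (2 : ℂ) ^ n := by
  have h : ∀ (m : ℕ) (gen : Fin m → CSSObservable n),
      LinearIndependent (ZMod 2) (fun i => (gen i).point) →
      2 ^ m * (List.ofFn fun i => (gen i).proj).prod.trace = (2 : ℂ) ^ n := by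
    intro m
    induction m with
    | zero =>
      intro gen _
      simp [Matrix.trace_one]
    | succ m ih =>
      intro gen hind
      obtain ⟨h1, h2⟩ := linearIndependent_finSucc.1 hind
      have h3 := ih (fun i => gen i.succ) h1
      have h4 := trace_disp_mul_prod_proj (fun i => gen i.succ) (gen 0).point h2
      rw [List.ofFn_succ, List.prod_cons]
      conv_lhs => rw [CSSObservable.proj, CSSObservable.op_eq]
      rw [Matrix.smul_mul, add_mul, one_mul, Matrix.smul_mul, Matrix.trace_smul, Matrix.trace_add,
        Matrix.trace_smul, h4, ← h3, pow_succ]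
      simp only [smul_eq_mul]
      ring
  exact h m C.gen C.indep

/-! ### CSS states have nonnegative Wigner representations -/

theorem cssStates_subset (n : ℕ) :
    cssStates n ⊆ {M | (∀ u, 0 ≤ wignerC M u) ∧ M.trace = 1} := by
  refine convexHull_min ?_ ?_
  · rintro _ ⟨C, rfl⟩
    refine ⟨fun u => ?_, ?_⟩
    · obtain ⟨T, hT0, -, hT⟩ := C.wignerSubstochastic_proj
      -- the state is obtained from the identity, whose representation is constant
      have h := hT 1 u
      simp only [mul_one, C.proj_mul_self] at h
      rw [h]
      refine Finset.sum_nonneg fun v _ => ?_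
      rw [wignerC_one]
      have h2 : 0 ≤ T u v * ((2 : ℝ) ^ n)⁻¹ := mul_nonneg (hT0 u v) (by positivity)
      simpa using Complex.zero_le_real.2 h2
    · have h := C.trace_proj
      exact mul_left_cancel₀ (pow_ne_zero n two_ne_zero) (h.trans (mul_one _).symm)
  · rintro M ⟨hM, hM'⟩ N ⟨hN, hN'⟩ a b ha hb hab
    refine ⟨fun u => ?_, ?_⟩
    · rw [← Complex.coe_smul, ← Complex.coe_smul, wignerC_add, wignerC_smul, wignerC_smul]
      exact add_nonneg (mul_nonneg (Complex.zero_le_real.2 ha) (hM u))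
        (mul_nonneg (Complex.zero_le_real.2 hb) (hN u))
    · rw [Matrix.trace_add, Matrix.trace_smul, Matrix.trace_smul, hM', hN', ← add_smul, hab, one_smul]

/-! ### Partial traces and completely CSS-preserving unitaries -/

theorem wignerC_traceLast {k m : ℕ} (M : Op (k + m)) (v : Phase k) :
    wignerC (traceLast M) v = ∑ w : Phase m, wignerC M (phaseAppend v w) := by
  rw [Fintype.sum_prod_type, wignerC_apply]
  simp only [wignerC_phaseAppend, traceLast, Finset.mul_sum]
  have h : ∀ c : Bits m, (∑ d : Bits m, ∑ g₁ : Bits k, ∑ g₂ : Bits m,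
      ((2 : ℂ) ^ k)⁻¹ * ((2 : ℂ) ^ m)⁻¹ * (sgn (v.2 ⬝ᵥ (v.1 + g₁)) * sgn (d ⬝ᵥ (c + g₂)) *
        M (Fin.append v.1 c) (Fin.append g₁ g₂))) =
      ∑ g₁ : Bits k, ((2 : ℂ) ^ k)⁻¹ * (sgn (v.2 ⬝ᵥ (v.1 + g₁)) *
        M (Fin.append v.1 c) (Fin.append g₁ c)) := by
    intro c
    rw [Finset.sum_comm]
    refine Finset.sum_congr rfl fun g₁ _ => ?_
    rw [Finset.sum_comm, Finset.sum_eq_single c]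
    · rw [← Finset.mul_sum, ← Finset.sum_mul, ← Finset.mul_sum, sum_sgn_dot]
      simp only [bits_add_self, if_true]
      field_simp
    · intro g₂ _ hg
      rw [← Finset.mul_sum, ← Finset.sum_mul, ← Finset.mul_sum, sum_sgn_dot, if_neg]
      · simp
      · rwa [bits_add_eq_zero_iff]
    · simp
  simp only [h]
  rw [Finset.sum_comm]

theorem WignerSubstochastic.traceLast {k m : ℕ} :
    WignerSubstochastic (fun M : Op (k + m) => traceLast M) := by
  refine ⟨fun v u => ∑ w : Phase m, if phaseAppend v w = u then 1 else 0,
    fun v u => Finset.sum_nonneg fun w _ => by split_ifs <;> simp, fun u => ?_, fun M v => ?_⟩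
  · rw [← sum_phaseAppend (fun u' : Phase (k + m) => if u' = u then (1 : ℝ) else 0)]
    simp
  · rw [wignerC_traceLast]
    push_cast
    simp only [Finset.sum_mul]
    rw [Finset.sum_comm]
    simp [apply_ite (Complex.ofReal)]

/-- The stabilizers `X(e_i) ⊗ X(e_i)` and `Z(e_i) ⊗ Z(e_i)` of the maximally entangled state of two
`n`-qubit systems. -/
def bellGen (n : ℕ) : Fin (n + n) → CSSObservable (n + n) :=
  Fin.addCases (fun i => ⟨true, Fin.append (Pi.single i 1) (Pi.single i 1), 0⟩)
    (fun i => ⟨false, Fin.append (Pi.single i 1) (Pi.single i 1), 0⟩)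

theorem pauliX_mul_pauliZ {n : ℕ} (a b : Bits n) :
    pauliX a * pauliZ b = sgn (b ⬝ᵥ a) • (pauliZ b * pauliX a) := by
  rw [pauliX_eq_disp, pauliZ_eq_disp, disp_mul_disp, disp_mul_disp]
  simp

theorem pauliX_mul_pauliX {n : ℕ} (a b : Bits n) : pauliX a * pauliX b = pauliX (a + b) := by
  rw [pauliX_eq_disp, pauliX_eq_disp, pauliX_eq_disp, disp_mul_disp]
  simp

theorem pauliZ_mul_pauliZ {n : ℕ} (a b : Bits n) : pauliZ a * pauliZ b = pauliZ (b + a) := by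
  simp only [pauliZ, Matrix.diagonal_mul_diagonal, add_dotProduct, sgn_add, mul_comm]

/-- The generators of the stabilizer group of the maximally entangled state. -/
def bell (n : ℕ) : CSSGenerators (n + n) (n + n) where
  gen := bellGen n
  comm := by
    have hd : ∀ i j : Fin n, (Fin.append (Pi.single i 1) (Pi.single i 1) : Bits (n + n)) ⬝ᵥ
        Fin.append (Pi.single j 1) (Pi.single j 1) = 0 := by
      intro i j
      rw [append_dotProduct_append]
      exact CharTwo.add_self_eq_zero _
    intro i j
    refine Fin.addCases (fun i => ?_) (fun i => ?_) i <;>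
      refine Fin.addCases (fun j => ?_) (fun j => ?_) j
    · simp [-Fin.natAdd_eq_addNat, bellGen, CSSObservable.op, pauliX_mul_pauliX, add_comm]
    · simp [-Fin.natAdd_eq_addNat, bellGen, CSSObservable.op, pauliX_mul_pauliZ, hd]
    · simp [-Fin.natAdd_eq_addNat, bellGen, CSSObservable.op, pauliX_mul_pauliZ, hd]
    · simp [-Fin.natAdd_eq_addNat, bellGen, CSSObservable.op, pauliZ_mul_pauliZ, add_comm]
  indep := by
    rw [Fintype.linearIndependent_iff]
    intro c hc i
    rw [Fin.sum_univ_add] at hc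
    simp only [bellGen, Fin.addCases_left, Fin.addCases_right, CSSObservable.point, if_true,
      Bool.false_eq_true, if_false] at hc
    refine Fin.addCases (fun i => ?_) (fun i => ?_) i
    · have h := congrFun (congrArg Prod.fst hc) (Fin.castAdd n i)
      simpa [Prod.fst_sum, Finset.sum_apply, Pi.single_apply] using h
    · have h := congrFun (congrArg Prod.snd hc) (Fin.castAdd n i)
      simpa [Prod.snd_sum, Finset.sum_apply, Pi.single_apply] using h

/-- Translating the rows by `(h, h)` does not change an operator that is fixed by all the
`X(e_i) ⊗ X(e_i)`. -/
theorem bell_translate {n : ℕ} {R : Type*} (F : Bits (n + n) → R)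
    (hF : ∀ (i : Fin n) (f : Bits (n + n)),
      F (f + Fin.append (Pi.single i 1) (Pi.single i 1)) = F f) (h : Bits n) (f : Bits (n + n)) :
    F (f + Fin.append h h) = F f := by
  have key : ∀ (s : Finset (Fin n)) (f : Bits (n + n)),
      F (f + ∑ i ∈ s, h i • Fin.append (Pi.single i 1) (Pi.single i 1)) = F f := by
    intro s
    induction s using Finset.induction_on with
    | empty => simp
    | insert i s hi ih =>
      intro f
      rw [Finset.sum_insert hi, ← add_assoc, ih]
      rcases zmod_two_cases (h i) with h0 | h1
      · rw [h0, zero_smul, add_zero]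
      · rw [h1, one_smul, hF]
  have hsum : Fin.append h h = ∑ i, h i • (Fin.append (Pi.single i 1) (Pi.single i 1) :
      Bits (n + n)) := by
    ext j
    refine Fin.addCases (fun j => ?_) (fun j => ?_) j <;>
      simp [-Fin.natAdd_eq_addNat, Finset.sum_apply, Pi.single_apply]
  rw [hsum, key]

/-- The stabilizer state of the generators `bell n` is the maximally entangled state. -/
theorem bell_proj_apply {n : ℕ} (f₁ f₂ g₁ g₂ : Bits n) :
    (bell n).proj (Fin.append f₁ f₂) (Fin.append g₁ g₂) =
      if f₁ = f₂ ∧ g₁ = g₂ then ((2 : ℂ) ^ n)⁻¹ else 0 := by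
  set P := (bell n).proj with hP
  have hX : ∀ i : Fin n, ((bell n).gen (Fin.castAdd n i)).op =
      disp (Fin.append (Pi.single i 1) (Pi.single i 1), 0) := by
    intro i
    simp [-Fin.natAdd_eq_addNat, bell, bellGen, CSSObservable.op_eq, CSSObservable.point]
  have hZ : ∀ i : Fin n, ((bell n).gen (Fin.natAdd n i)).op =
      disp (0, Fin.append (Pi.single i 1) (Pi.single i 1)) := by
    intro i
    simp [-Fin.natAdd_eq_addNat, bell, bellGen, CSSObservable.op_eq, CSSObservable.point]
  have hXl : ∀ h f g, P (f + Fin.append h h) g = P f g := by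
    intro h f g
    refine bell_translate (fun f => P f g) (fun i f => ?_) h f
    have h1 := congrFun (congrFun ((bell n).op_mul_proj (Fin.castAdd n i)) f) g
    rw [hX, disp_mul_apply] at h1
    simpa using h1
  have hXr : ∀ h f g, P f (g + Fin.append h h) = P f g := by
    intro h f g
    refine bell_translate (fun g => P f g) (fun i g => ?_) h g
    have h1 := congrFun (congrFun ((bell n).proj_mul_op (Fin.castAdd n i)) f) g
    rw [hX, mul_disp_apply] at h1
    simpa using h1
  have hdot : ∀ (i : Fin n) (f₁ f₂ : Bits n),
      Fin.append (Pi.single i 1) (Pi.single i 1) ⬝ᵥ Fin.append f₁ f₂ = f₁ i + f₂ i := by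
    intro i f₁ f₂
    simp [append_dotProduct_append]
  have hzero : ∀ (c : ZMod 2) (z : ℂ), c ≠ 0 → sgn c * z = z → z = 0 := by
    intro c z hc h
    rw [(zmod_two_cases c).resolve_left hc, sgn_one] at h
    linear_combination (-1 / 2) * h
  have hne : ∀ f₁ f₂ : Bits n, f₁ ≠ f₂ → ∃ i, f₁ i + f₂ i ≠ 0 := by
    intro f₁ f₂ h
    by_contra hcon
    push Not at hcon
    exact h ((bits_add_eq_zero_iff f₂ f₁).1 (by rw [add_comm]; exact funext hcon))
  -- the `Z`-stabilizers confine the support to `f₁ = f₂` and `g₁ = g₂`; the `X`-stabilizers make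
  -- the entries there constant, and the trace fixes the constant
  have hZl : ∀ f₁ f₂ g, f₁ ≠ f₂ → P (Fin.append f₁ f₂) g = 0 := by
    intro f₁ f₂ g h
    obtain ⟨i, hi⟩ := hne f₁ f₂ h
    have h1 := congrFun (congrFun ((bell n).op_mul_proj (Fin.natAdd n i)) (Fin.append f₁ f₂)) g
    rw [hZ, disp_mul_apply, hdot] at h1
    exact hzero _ _ hi (by simpa using h1)
  have hZr : ∀ f g₁ g₂, g₁ ≠ g₂ → P f (Fin.append g₁ g₂) = 0 := by
    intro f g₁ g₂ h
    obtain ⟨i, hi⟩ := hne g₁ g₂ h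
    have h1 := congrFun (congrFun ((bell n).proj_mul_op (Fin.natAdd n i)) f) (Fin.append g₁ g₂)
    rw [hZ, mul_disp_apply, add_zero, hdot] at h1
    exact hzero _ _ hi (by simpa [mul_comm] using h1)
  have hconst : ∀ f g : Bits n, P (Fin.append f f) (Fin.append g g) = P 0 0 := by
    intro f g
    have h1 := hXl f 0 (Fin.append g g)
    have h2 := hXr g 0 0
    rw [zero_add] at h1 h2
    exact h1.trans h2
  have htr : P.trace = 1 :=
    mul_left_cancel₀ (pow_ne_zero (n + n) two_ne_zero) ((bell n).trace_proj.trans (mul_one _).symm)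
  have hc : P 0 0 = ((2 : ℂ) ^ n)⁻¹ := by
    have h2 : P.trace = (2 : ℂ) ^ n * P 0 0 := by
      simp only [Matrix.trace, Matrix.diag]
      rw [sum_bits_append]
      have h3 : ∀ f : Bits n, ∑ f₂ : Bits n, P (Fin.append f f₂) (Fin.append f f₂) = P 0 0 := by
        intro f
        rw [Finset.sum_eq_single f, hconst]
        · intro f₂ _ h
          exact hZl _ _ _ (Ne.symm h)
        · simp
      simp [h3]
    rw [htr] at h2
    exact eq_inv_of_mul_eq_one_right h2.symm
  split_ifs with h
  · rw [h.1, h.2, hconst, hc]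
  · rcases not_and_or.1 h with h | h
    · exact hZl _ _ _ h
    · exact hZr _ _ _ h

theorem wignerC_phasePoint_conj {n : ℕ} (V : Op n) (u v : Phase n) :
    wignerC (V * phasePoint u * V.conjTranspose) v = ((2 : ℂ) ^ n)⁻¹ *
      ∑ g₁, ∑ g₂, sgn (u.2 ⬝ᵥ (u.1 + g₁)) * sgn (v.2 ⬝ᵥ (v.1 + g₂)) *
        (V v.1 u.1 * star (V g₂ g₁)) := by
  rw [wignerC_apply, Finset.sum_comm]
  congr 1
  refine Finset.sum_congr rfl fun g₂ _ => ?_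
  rw [Matrix.mul_apply, Finset.mul_sum]
  refine Finset.sum_congr rfl fun g₁ _ => ?_
  rw [Matrix.mul_apply, Finset.sum_eq_single u.1]
  · simp only [phasePoint_apply, if_true, Matrix.conjTranspose_apply]
    ring
  · intro f _ hf
    simp [phasePoint_apply, hf]
  · simp

theorem one_tensor_conj_bell_apply {n : ℕ} (V : Op n) (f₁ f₂ g₁ g₂ : Bits n) :
    (tensor (1 : Op n) V * (bell n).proj * (tensor (1 : Op n) V).conjTranspose)
      (Fin.append f₁ f₂) (Fin.append g₁ g₂) = ((2 : ℂ) ^ n)⁻¹ * (V f₂ f₁ * star (V g₂ g₁)) := by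
  have h1 : ∀ h₁ h₂ : Bits n, (tensor (1 : Op n) V * (bell n).proj)
      (Fin.append f₁ f₂) (Fin.append h₁ h₂) =
        if h₁ = h₂ then ((2 : ℂ) ^ n)⁻¹ * V f₂ f₁ else 0 := by
    intro h₁ h₂
    rw [Matrix.mul_apply, sum_bits_append, Finset.sum_eq_single f₁, Finset.sum_eq_single f₁]
    · rw [tensor_append, bell_proj_apply]
      simp [mul_comm]
    · intro y _ hy
      rw [bell_proj_apply, if_neg (fun h => hy h.1.symm), mul_zero]
    · simp
    · intro x _ hx
      refine Finset.sum_eq_zero fun y _ => ?_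
      rw [tensor_append, Matrix.one_apply_ne (Ne.symm hx), zero_mul, zero_mul]
    · simp
  rw [Matrix.mul_apply, sum_bits_append, Finset.sum_eq_single g₁, Finset.sum_eq_single g₁]
  · rw [h1, Matrix.conjTranspose_apply, tensor_append]
    simp [mul_assoc]
  · intro y _ hy
    rw [h1, if_neg (Ne.symm hy), zero_mul]
  · simp
  · intro x _ hx
    refine Finset.sum_eq_zero fun y _ => ?_
    rw [Matrix.conjTranspose_apply, tensor_append, Matrix.one_apply_ne (Ne.symm hx), zero_mul,
      star_zero, mul_zero]
  · simp

/-- The matrix of `M ↦ V M V†` in the Wigner representation is, up to a factor, the Wigner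
representation of its Choi state. -/
theorem wignerC_one_tensor_conj_bell {n : ℕ} (V : Op n) (u v : Phase n) :
    wignerC (tensor (1 : Op n) V * (bell n).proj * (tensor (1 : Op n) V).conjTranspose)
      (phaseAppend u v) =
      ((4 : ℂ) ^ n)⁻¹ * wignerC (V * phasePoint u * V.conjTranspose) v := by
  rw [wignerC_phaseAppend, wignerC_phasePoint_conj]
  simp only [one_tensor_conj_bell_apply]
  have h4 : ((4 : ℂ) ^ n)⁻¹ = ((2 : ℂ) ^ n)⁻¹ * ((2 : ℂ) ^ n)⁻¹ := by
    rw [← mul_inv, ← mul_pow]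
    norm_num
  rw [h4]
  congr 1
  simp only [Finset.mul_sum]
  refine Finset.sum_congr rfl fun _ _ => Finset.sum_congr rfl fun _ _ => ?_
  ring

theorem trace_phasePoint {n : ℕ} (u : Phase n) : (phasePoint u).trace = 1 := by
  simp only [Matrix.trace, Matrix.diag, phasePoint_apply]
  simp [-dotProduct_add]

/-- Completely CSS-preserving unitaries are stochastic in the Wigner representation, because their
Choi state is a CSS state. -/
theorem CompletelyCSSPreserving.wignerSubstochastic {n : ℕ} {V : Op n}
    (hV : CompletelyCSSPreserving V) (hU : V ∈ Matrix.unitaryGroup (Bits n) ℂ) :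
    WignerSubstochastic (fun M => V * M * V.conjTranspose) := by
  have hpos : ∀ u v, 0 ≤ wignerC (V * phasePoint u * V.conjTranspose) v := by
    intro u v
    have h1 := (cssStates_subset _ (hV n _ (subset_convexHull ℝ _ ⟨bell n, rfl⟩))).1
      (phaseAppend u v)
    rw [wignerC_one_tensor_conj_bell] at h1
    have h4 : (0 : ℂ) ≤ (4 : ℂ) ^ n := by simp
    have h5 := mul_nonneg h4 h1
    rwa [mul_inv_cancel_left₀ (pow_ne_zero n four_ne_zero)] at h5
  have hre : ∀ u v, (((wignerC (V * phasePoint u * V.conjTranspose) v).re : ℝ) : ℂ) =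
      wignerC (V * phasePoint u * V.conjTranspose) v := fun u v =>
    (Complex.eq_re_of_ofReal_le (r := 0) (by simpa using hpos u v)).symm
  refine ⟨fun v u => (wignerC (V * phasePoint u * V.conjTranspose) v).re,
    fun v u => (Complex.nonneg_iff.1 (hpos u v)).1, fun u => le_of_eq ?_, fun M v => ?_⟩
  · rw [← Complex.re_sum, sum_wignerC, Matrix.trace_mul_cycle, ← Matrix.star_eq_conjTranspose,
      Matrix.mem_unitaryGroup_iff'.1 hU, one_mul, trace_phasePoint, Complex.one_re]
  · simp only [hre]
    conv_lhs => rw [← sum_wignerC_smul_phasePoint M]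
    simp only [Matrix.mul_sum, Matrix.sum_mul, Matrix.mul_smul, Matrix.smul_mul, wignerC_sum,
      wignerC_smul]
    exact Finset.sum_congr rfl fun u _ => mul_comm _ _

/-! ### Code projections -/

theorem CSSCodeProjection.wignerSubstochastic {k m : ℕ} (K : CSSCodeProjection k m) :
    WignerSubstochastic K.apply :=
  WignerSubstochastic.traceLast.comp
    ((K.preserving.wignerSubstochastic K.unitary).comp K.code.wignerSubstochastic_proj)

theorem trace_tensor_one {k m : ℕ} (ω : Op m) : (tensor (1 : Op k) ω).trace = 2 ^ k * ω.trace := by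
  simp only [Matrix.trace, Matrix.diag]
  rw [sum_bits_append]
  simp [tensor_append]

/-- A code projection maps the maximally mixed state to a multiple of the maximally mixed state. -/
theorem CSSCodeProjection.apply_maxMixed {k m : ℕ} (K : CSSCodeProjection k m) :
    K.apply (maxMixed (k + m)) = ((2 : ℂ) ^ (k + m))⁻¹ • (1 : Op k) := by
  obtain ⟨ω, hω⟩ := K.decodes
  have htr : ω.trace = 1 := by
    have h1 : (K.V * K.code.proj * K.V.conjTranspose).trace = K.code.proj.trace := by
      rw [Matrix.trace_mul_cycle, ← Matrix.star_eq_conjTranspose,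
        Matrix.mem_unitaryGroup_iff'.1 K.unitary, one_mul]
    have h2 := K.code.trace_proj
    rw [← h1, hω, trace_tensor_one, pow_add] at h2
    have h3 : (2 : ℂ) ^ k * 2 ^ m ≠ 0 := by positivity
    refine mul_left_cancel₀ h3 ?_
    linear_combination h2
  have h : K.apply (maxMixed (k + m)) = ((2 : ℂ) ^ (k + m))⁻¹ • traceLast (tensor (1 : Op k) ω) := by
    rw [← hω, CSSCodeProjection.apply, maxMixed, Matrix.mul_smul, mul_one, Matrix.smul_mul,
      K.code.proj_mul_self, Matrix.mul_smul, Matrix.smul_mul]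
    ext f g
    simp [traceLast, Finset.mul_sum]
  rw [h]
  congr 1
  ext f g
  simp only [traceLast, tensor_append, ← Finset.mul_sum]
  change (1 : Op k) f g * ω.trace = _
  rw [htr, mul_one]

/-! ### Log-convexity of the flagged Rényi sums -/

/-- The weight `1 - 2^{k-n}` of the branch of `τ_{n,k}` in which the projection fails. -/
noncomputable def failWeight (k : ℕ) (n : ℝ) : ℝ := 1 - (2 : ℝ) ^ ((k : ℝ) - n)

theorem failWeight_nonneg {k : ℕ} {n : ℝ} (h : (k : ℝ) ≤ n) : 0 ≤ failWeight k n :=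
  sub_nonneg.2 (Real.rpow_le_one_of_one_le_of_nonpos one_le_two (sub_nonpos.2 h))

theorem failWeight_pos {k : ℕ} {n : ℝ} (h : (k : ℝ) < n) : 0 < failWeight k n :=
  sub_pos.2 (Real.rpow_lt_one_of_one_lt_of_neg one_lt_two (sub_neg.2 h))

theorem failWeight_self (k : ℕ) : failWeight k k = 0 := by
  simp [failWeight]

/-- Hölder's inequality for two summands, with conjugate exponents `1/a` and `1/b`. -/
theorem rpow_mul_rpow_add_le {a b x₁ x₂ y₁ y₂ : ℝ} (ha : 0 < a) (hb : 0 < b) (hab : a + b = 1)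
    (hx₁ : 0 ≤ x₁) (hx₂ : 0 ≤ x₂) (hy₁ : 0 ≤ y₁) (hy₂ : 0 ≤ y₂) :
    x₁ ^ a * y₁ ^ b + x₂ ^ a * y₂ ^ b ≤ (x₁ + x₂) ^ a * (y₁ + y₂) ^ b := by
  rcases (add_nonneg hx₁ hx₂).eq_or_lt with hX | hX
  · have h1 : x₁ = 0 := by linarith
    have h2 : x₂ = 0 := by linarith
    simp [h1, h2, Real.zero_rpow ha.ne']
  rcases (add_nonneg hy₁ hy₂).eq_or_lt with hY | hY
  · have h1 : y₁ = 0 := by linarith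
    have h2 : y₂ = 0 := by linarith
    simp [h1, h2, Real.zero_rpow hb.ne']
  have h1 := Real.geom_mean_le_arith_mean2_weighted ha.le hb.le (div_nonneg hx₁ hX.le)
    (div_nonneg hy₁ hY.le) hab
  have h2 := Real.geom_mean_le_arith_mean2_weighted ha.le hb.le (div_nonneg hx₂ hX.le)
    (div_nonneg hy₂ hY.le) hab
  have h3 : a * (x₁ / (x₁ + x₂)) + b * (y₁ / (y₁ + y₂)) +
      (a * (x₂ / (x₁ + x₂)) + b * (y₂ / (y₁ + y₂))) = 1 := by
    rw [← hab]
    field_simp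
    ring
  rw [Real.div_rpow hx₁ hX.le, Real.div_rpow hy₁ hY.le, div_mul_div_comm] at h1
  rw [Real.div_rpow hx₂ hX.le, Real.div_rpow hy₂ hY.le, div_mul_div_comm] at h2
  have hpos : 0 < (x₁ + x₂) ^ a * (y₁ + y₂) ^ b := by positivity
  rw [← div_le_one hpos, add_div]
  linarith

/-- The weight of the failing branch is log-concave. -/
theorem failWeight_logConcave {k : ℕ} {a b x y : ℝ} (ha : 0 < a) (hb : 0 < b) (hab : a + b = 1)
    (hx : (k : ℝ) ≤ x) (hy : (k : ℝ) ≤ y) :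
    failWeight k x ^ a * failWeight k y ^ b ≤ failWeight k (a * x + b * y) := by
  have h := rpow_mul_rpow_add_le ha hb hab (failWeight_nonneg hx)
    (Real.rpow_nonneg zero_le_two ((k : ℝ) - x)) (failWeight_nonneg hy)
    (Real.rpow_nonneg zero_le_two ((k : ℝ) - y))
  have h1 : ∀ z, failWeight k z + (2 : ℝ) ^ ((k : ℝ) - z) = 1 := fun z => sub_add_cancel _ _
  have h2 : ((2 : ℝ) ^ ((k : ℝ) - x)) ^ a * ((2 : ℝ) ^ ((k : ℝ) - y)) ^ b =
      (2 : ℝ) ^ ((k : ℝ) - (a * x + b * y)) := by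
    rw [← Real.rpow_mul zero_le_two, ← Real.rpow_mul zero_le_two, ← Real.rpow_add two_pos]
    congr 1
    linear_combination (k : ℝ) * hab
  rw [h1, h1, h2, Real.one_rpow, Real.one_rpow, one_mul] at h
  linarith [h1 (a * x + b * y)]

/-- The properties of `+` and `max` on nonnegative reals that make Rényi divergences of flagged
states log-convex, for finite and for infinite order respectively. -/
structure IsRenyiSum (φ : ℝ → ℝ → ℝ) : Prop where
  left_le : ∀ {x y}, 0 ≤ x → 0 ≤ y → x ≤ φ x y
  right_le : ∀ {x y}, 0 ≤ x → 0 ≤ y → y ≤ φ x y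
  mono : ∀ {x y y'}, y ≤ y' → φ x y ≤ φ x y'
  holder : ∀ {a b x₁ x₂ y₁ y₂ : ℝ}, 0 < a → 0 < b → a + b = 1 → 0 ≤ x₁ → 0 ≤ x₂ → 0 ≤ y₁ → 0 ≤ y₂ →
    φ (x₁ ^ a * y₁ ^ b) (x₂ ^ a * y₂ ^ b) ≤ φ x₁ x₂ ^ a * φ y₁ y₂ ^ b

theorem isRenyiSum_add : IsRenyiSum (fun x y => x + y) where
  left_le _ hy := le_add_of_nonneg_right hy
  right_le hx _ := le_add_of_nonneg_left hx
  mono h := by gcongr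
  holder := rpow_mul_rpow_add_le

theorem isRenyiSum_max : IsRenyiSum max where
  left_le _ _ := le_max_left _ _
  right_le _ _ := le_max_right _ _
  mono h := max_le_max le_rfl h
  holder {a b x₁ x₂ y₁ y₂} ha hb _ hx₁ hx₂ hy₁ hy₂ := by
    have hx := hx₁.trans (le_max_left x₁ x₂)
    refine max_le ?_ ?_
    · gcongr
      · exact le_max_left _ _
      · exact le_max_left _ _
    · gcongr
      · exact le_max_right _ _
      · exact le_max_right _ _

/-- The Rényi sum of `ρ_p` relative to `τ_{n,k}`: the succeeding branch contributes `A 2^{en}` and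
the failing one `B (1-2^{k-n})^{-e}`, where `e = α - 1` for finite `α` and `e = 1` for `α = ∞`. -/
noncomputable def flaggedSum (φ : ℝ → ℝ → ℝ) (k : ℕ) (e A B n : ℝ) : ℝ :=
  φ (A * (2 : ℝ) ^ (n * e)) (B * failWeight k n ^ (-e))

/-- The Rényi divergence with Rényi sum `flaggedSum`. -/
noncomputable def flaggedDiv (φ : ℝ → ℝ → ℝ) (k : ℕ) (e A B n : ℝ) : ℝ :=
  e⁻¹ * Real.logb 2 (flaggedSum φ k e A B n)

section Flagged

variable {φ : ℝ → ℝ → ℝ} (hφ : IsRenyiSum φ) {k : ℕ} {e A B : ℝ} (he : 0 < e) (hA : 0 < A)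
  (hB : 0 ≤ B)

theorem reject_nonneg (hB : 0 ≤ B) {n : ℝ} (hn : (k : ℝ) ≤ n) :
    0 ≤ B * failWeight k n ^ (-e) :=
  mul_nonneg hB (Real.rpow_nonneg (failWeight_nonneg hn) _)

include hφ hA hB

theorem accept_le_flaggedSum {n : ℝ} (hn : (k : ℝ) ≤ n) :
    A * (2 : ℝ) ^ (n * e) ≤ flaggedSum φ k e A B n :=
  hφ.left_le (by positivity) (reject_nonneg hB hn)

theorem flaggedSum_pos {n : ℝ} (hn : (k : ℝ) ≤ n) : 0 < flaggedSum φ k e A B n :=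
  lt_of_lt_of_le (by positivity) (accept_le_flaggedSum hφ hA hB hn)

include he

theorem flaggedSum_logConvex {a b x y : ℝ} (ha : 0 < a) (hb : 0 < b) (hab : a + b = 1)
    (hx : (k : ℝ) ≤ x) (hy : (k : ℝ) ≤ y) (h : B = 0 ∨ ((k : ℝ) < x ∧ (k : ℝ) < y)) :
    flaggedSum φ k e A B (a * x + b * y) ≤
      flaggedSum φ k e A B x ^ a * flaggedSum φ k e A B y ^ b := by
  have h1 : A * (2 : ℝ) ^ ((a * x + b * y) * e) =
      (A * (2 : ℝ) ^ (x * e)) ^ a * (A * (2 : ℝ) ^ (y * e)) ^ b := by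
    rw [Real.mul_rpow hA.le (by positivity), Real.mul_rpow hA.le (by positivity),
      ← Real.rpow_mul zero_le_two, ← Real.rpow_mul zero_le_two, mul_mul_mul_comm,
      ← Real.rpow_add hA, ← Real.rpow_add two_pos, hab, Real.rpow_one]
    congr 2
    ring
  have h2 : B * failWeight k (a * x + b * y) ^ (-e) ≤
      (B * failWeight k x ^ (-e)) ^ a * (B * failWeight k y ^ (-e)) ^ b := by
    rcases h with rfl | ⟨hx', hy'⟩
    · simp [Real.zero_rpow ha.ne']
    rcases hB.eq_or_lt with rfl | hB'
    · simp [Real.zero_rpow ha.ne']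
    have px := failWeight_pos hx'
    have py := failWeight_pos hy'
    rw [Real.mul_rpow hB (by positivity), Real.mul_rpow hB (by positivity), mul_mul_mul_comm,
      ← Real.rpow_add hB', hab, Real.rpow_one, ← Real.rpow_mul px.le, ← Real.rpow_mul py.le,
      mul_comm (-e) a, mul_comm (-e) b, Real.rpow_mul px.le, Real.rpow_mul py.le,
      ← Real.mul_rpow (by positivity) (by positivity)]
    gcongr ?_ * ?_
    exact Real.rpow_le_rpow_of_nonpos (by positivity) (failWeight_logConcave ha hb hab hx hy)
      (neg_nonpos.2 he.le)
  calc _ ≤ _ := hφ.mono h2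
    _ ≤ _ := by
      rw [h1]
      exact hφ.holder ha hb hab (by positivity) (reject_nonneg hB hx) (by positivity)
        (reject_nonneg hB hy)

theorem flaggedDiv_convex {a b x y : ℝ} (ha : 0 < a) (hb : 0 < b) (hab : a + b = 1)
    (hx : (k : ℝ) ≤ x) (hy : (k : ℝ) ≤ y) (h : B = 0 ∨ ((k : ℝ) < x ∧ (k : ℝ) < y)) :
    flaggedDiv φ k e A B (a * x + b * y) ≤
      a * flaggedDiv φ k e A B x + b * flaggedDiv φ k e A B y := by
  have hFx := flaggedSum_pos (e := e) hφ hA hB hx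
  have hFy := flaggedSum_pos (e := e) hφ hA hB hy
  have hz : (k : ℝ) ≤ a * x + b * y := by
    have h1 := mul_le_mul_of_nonneg_left hx ha.le
    have h2 := mul_le_mul_of_nonneg_left hy hb.le
    have h3 : a * (k : ℝ) + b * k = k := by rw [← add_mul, hab, one_mul]
    linarith
  have h1 := Real.logb_le_logb_of_le one_lt_two (flaggedSum_pos hφ hA hB hz)
    (flaggedSum_logConvex hφ he hA hB ha hb hab hx hy h)
  rw [Real.logb_mul (by positivity) (by positivity), Real.logb_rpow_eq_mul_logb_of_pos hFx,
    Real.logb_rpow_eq_mul_logb_of_pos hFy] at h1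
  have h2 := mul_le_mul_of_nonneg_left h1 (inv_nonneg.2 he.le)
  simp only [flaggedDiv]
  linarith

theorem le_flaggedDiv_of_accept {n : ℝ} (hn : (k : ℝ) ≤ n) :
    n + e⁻¹ * Real.logb 2 A ≤ flaggedDiv φ k e A B n := by
  have h1 := Real.logb_le_logb_of_le one_lt_two (by positivity)
    (accept_le_flaggedSum (e := e) hφ hA hB hn)
  rw [Real.logb_mul hA.ne' (by positivity), Real.logb_rpow two_pos (by norm_num)] at h1
  have h2 := mul_le_mul_of_nonneg_left h1 (inv_nonneg.2 he.le)
  refine le_trans (le_of_eq ?_) h2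
  field_simp
  ring

theorem le_flaggedDiv_of_reject (hB' : 0 < B) {n : ℝ} (hn : (k : ℝ) < n) :
    e⁻¹ * Real.logb 2 B - Real.logb 2 (failWeight k n) ≤ flaggedDiv φ k e A B n := by
  have hf := failWeight_pos hn
  have h0 : B * failWeight k n ^ (-e) ≤ flaggedSum φ k e A B n :=
    hφ.right_le (by positivity) (reject_nonneg hB hn.le)
  have h1 := Real.logb_le_logb_of_le one_lt_two (by positivity) h0
  rw [Real.logb_mul hB'.ne' (by positivity), Real.logb_rpow_eq_mul_logb_of_pos hf] at h1
  have h2 := mul_le_mul_of_nonneg_left h1 (inv_nonneg.2 he.le)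
  refine le_trans (le_of_eq ?_) h2
  field_simp
  ring

/-! ### Concavity and asymptotics of the divergence difference -/

variable {D : ℝ → EReal} {c : ℝ}
  (hD : ∀ n : ℝ, (k : ℝ) ≤ n → (B = 0 ∨ (k : ℝ) < n) →
    D n = ((n * c - flaggedDiv φ k e A B n : ℝ) : EReal))

include hD

theorem divDiff_concave (hDk : B ≠ 0 → D k = ⊥) {a b x y : ℝ} (hx : (k : ℝ) ≤ x)
    (hy : (k : ℝ) ≤ y) (ha : 0 ≤ a) (hb : 0 ≤ b) (hab : a + b = 1) :
    (a : EReal) * D x + (b : EReal) * D y ≤ D (a * x + b * y) := by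
  rcases ha.eq_or_lt with rfl | ha
  · obtain rfl : b = 1 := by linarith
    simp
  rcases hb.eq_or_lt with rfl | hb
  · obtain rfl : a = 1 := by linarith
    simp
  -- at the endpoint `k` the difference is `⊥`, unless the failing branch is absent
  by_cases hB0 : B ≠ 0 ∧ (x = k ∨ y = k)
  · rcases hB0 with ⟨h0, rfl | rfl⟩
    · rw [hDk h0, EReal.coe_mul_bot_of_pos ha, EReal.bot_add]
      exact bot_le
    · rw [hDk h0, EReal.coe_mul_bot_of_pos hb, EReal.add_bot]
      exact bot_le
  have h : B = 0 ∨ ((k : ℝ) < x ∧ (k : ℝ) < y) := by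
    by_contra hcon
    push Not at hcon
    refine hB0 ⟨hcon.1, ?_⟩
    by_contra h2
    push Not at h2
    exact absurd (lt_of_le_of_ne hy (Ne.symm h2.2))
      (not_lt.2 (hcon.2 (lt_of_le_of_ne hx (Ne.symm h2.1))))
  have hz : (k : ℝ) ≤ a * x + b * y ∧ (B = 0 ∨ (k : ℝ) < a * x + b * y) := by
    have h1 := mul_le_mul_of_nonneg_left hx ha.le
    have h2 := mul_le_mul_of_nonneg_left hy hb.le
    have h3 : a * (k : ℝ) + b * k = k := by rw [← add_mul, hab, one_mul]
    refine ⟨by linarith, h.imp_right fun h => ?_⟩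
    have h4 := mul_lt_mul_of_pos_left h.1 ha
    linarith
  rw [hD x hx (h.imp_right And.left), hD y hy (h.imp_right And.right), hD _ hz.1 hz.2,
    ← EReal.coe_mul, ← EReal.coe_mul, ← EReal.coe_add, EReal.coe_le_coe_iff]
  have := flaggedDiv_convex hφ he hA hB ha hb hab hx hy h
  linarith

theorem divDiff_tendsto_nhdsGT (hB' : 0 < B) : Tendsto D (𝓝[>] (k : ℝ)) (𝓝 ⊥) := by
  have hlim : Tendsto (fun n : ℝ => n * c - flaggedDiv φ k e A B n) (𝓝[>] (k : ℝ)) atBot := by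
    have hf : Tendsto (failWeight k) (𝓝[>] (k : ℝ)) (𝓝[≠] 0) := by
      refine tendsto_nhdsWithin_iff.2 ⟨?_, ?_⟩
      · have hc : Continuous (failWeight k) := by
          unfold failWeight
          exact continuous_const.sub
            (Continuous.rpow continuous_const (by fun_prop) fun _ => Or.inl two_ne_zero)
        have := hc.tendsto (k : ℝ)
        rw [failWeight_self] at this
        exact this.mono_left nhdsWithin_le_nhds
      · filter_upwards [self_mem_nhdsWithin] with n hn using (failWeight_pos hn).ne'
    have h1 : Tendsto (fun n : ℝ => (n * c - e⁻¹ * Real.logb 2 B) + Real.logb 2 (failWeight k n))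
        (𝓝[>] (k : ℝ)) atBot := by
      refine Tendsto.add_atBot (C := k * c - e⁻¹ * Real.logb 2 B) ?_ ?_
      · exact ((tendsto_id.mul_const c).sub_const _).mono_left nhdsWithin_le_nhds
      · exact (Real.tendsto_log_nhdsNE_zero.comp hf).atBot_div_const (Real.log_pos one_lt_two)
    refine tendsto_atBot_mono' _ ?_ h1
    filter_upwards [self_mem_nhdsWithin] with n hn
    have := le_flaggedDiv_of_reject hφ he hA hB hB' hn
    linarith
  refine (EReal.tendsto_coe_nhds_bot_iff.2 hlim).congr' ?_
  filter_upwards [self_mem_nhdsWithin] with n hn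
  exact (hD n (le_of_lt hn) (Or.inr hn)).symm

theorem divDiff_tendsto_atTop (hc : c < 1) : Tendsto D atTop (𝓝 ⊥) := by
  have hlim : Tendsto (fun n : ℝ => n * c - flaggedDiv φ k e A B n) atTop atBot := by
    have h1 : Tendsto (fun n : ℝ => n * (c - 1) + -(e⁻¹ * Real.logb 2 A)) atTop atBot :=
      tendsto_atBot_add_const_right _ _ (tendsto_id.atTop_mul_const_of_neg (sub_neg.2 hc))
    refine tendsto_atBot_mono' _ ?_ h1
    filter_upwards [eventually_ge_atTop (k : ℝ)] with n hn
    have := le_flaggedDiv_of_accept hφ he hA hB hn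
    linarith
  refine (EReal.tendsto_coe_nhds_bot_iff.2 hlim).congr' ?_
  filter_upwards [eventually_gt_atTop (k : ℝ)] with n hn
  exact (hD n (le_of_lt hn) (Or.inr hn)).symm

theorem divDiff_bddAbove (hc : c < 1) :
    sSup ((fun n : ℝ => (n : EReal)) '' {n : ℝ | (k : ℝ) ≤ n ∧ 0 ≤ D n}) < ⊤ := by
  obtain ⟨N, hN⟩ := (((divDiff_tendsto_atTop hφ he hA hB hD hc).eventually_lt_const
    (EReal.bot_lt_zero)).exists_forall_of_atTop)
  refine lt_of_le_of_lt (sSup_le ?_) (EReal.coe_lt_top N)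
  rintro _ ⟨n, ⟨-, hn⟩, rfl⟩
  by_contra hcon
  exact absurd hn (not_le.2 (hN n (le_of_lt (EReal.coe_lt_coe_iff.1 (not_le.1 hcon)))))

end Flagged

/-! ### Real Wigner representations of rebit states and flagged states -/

theorem ofReal_wigner {n : ℕ} {M : Op n} (hM : ∀ i j, (M i j).im = 0) (u : Phase n) :
    (wigner M u : ℂ) = wignerC M u :=
  Complex.ext rfl (wignerC_im M hM u).symm

theorem sum_wigner {n : ℕ} {M : Op n} (hM : M.trace = 1) : ∑ u, wigner M u = 1 := by
  have h := congrArg Complex.re (sum_wignerC M)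
  rw [Complex.re_sum, hM] at h
  exact h

theorem wigner_nonneg_of_mem_cssStates {n : ℕ} {σ : Op n} (hσ : σ ∈ cssStates n) (u : Phase n) :
    0 ≤ wigner σ u :=
  (Complex.nonneg_iff.1 ((cssStates_subset n hσ).1 u)).1

theorem wigner_maxMixed (n : ℕ) (u : Phase n) : wigner (maxMixed n) u = ((4 : ℝ) ^ n)⁻¹ := by
  have h : wignerC (maxMixed n) u = (((4 : ℝ) ^ n)⁻¹ : ℝ) := by
    rw [wignerC_maxMixed]
    simp
  rw [wigner, h, Complex.ofReal_re]

theorem wignerC_ketbra (x : ZMod 2) (w : Phase 1) :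
    wignerC (ketbra x) w = ((if w.1 0 = x then 1 / 2 else 0 : ℝ) : ℂ) := by
  rw [wignerC_apply, Finset.sum_eq_single w.1]
  · simp only [ketbra, Matrix.diagonal_apply_eq, bits_add_self, dotProduct_zero, sgn_zero]
    split_ifs <;> simp
  · intro g _ hg
    rw [ketbra, Matrix.diagonal_apply_ne _ (Ne.symm hg), mul_zero]
  · simp

theorem wigner_flagged {k : ℕ} (s t : ℝ) (M N : Op k) (v : Phase k) (w : Phase 1) :
    wigner ((s : ℂ) • tensor M (ketbra 0) + (t : ℂ) • tensor N (ketbra 1)) (phaseAppend v w) =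
      if w.1 0 = 0 then s * wigner M v / 2 else t * wigner N v / 2 := by
  rw [wigner, wignerC_add, wignerC_smul, wignerC_smul, wignerC_tensor, wignerC_tensor,
    wignerC_ketbra, wignerC_ketbra, Complex.add_re, Complex.re_ofReal_mul, Complex.re_ofReal_mul,
    Complex.re_mul_ofReal, Complex.re_mul_ofReal]
  rcases zmod_two_cases (w.1 0) with h | h <;> simp [h, wigner] <;> ring

theorem wigner_rhoP {k : ℕ} (p : ℝ) (ρ' σ : Op k) (v : Phase k) (w : Phase 1) :
    wigner (rhoP p ρ' σ) (phaseAppend v w) =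
      if w.1 0 = 0 then p * wigner ρ' v / 2 else (1 - p) * wigner σ v / 2 :=
  wigner_flagged p (1 - p) ρ' σ v w

/-- The value of the succeeding branch of the Wigner representation of `τ_{n,k}`, up to the factor
`1/2` from the flag. -/
noncomputable def tauWeight (k : ℕ) (n : ℝ) : ℝ := (2 : ℝ) ^ ((k : ℝ) - n) * ((4 : ℝ) ^ k)⁻¹

theorem tauWeight_pos (k : ℕ) (n : ℝ) : 0 < tauWeight k n := by
  unfold tauWeight
  positivity

theorem tauWeight_eq (k : ℕ) (n : ℝ) : tauWeight k n = (2 : ℝ) ^ (-(n + k)) := by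
  have h : ((4 : ℝ) ^ k)⁻¹ = (2 : ℝ) ^ (-(2 * k : ℝ)) := by
    rw [Real.rpow_neg zero_le_two, Real.rpow_mul zero_le_two, Real.rpow_natCast]
    norm_num
  rw [tauWeight, h, ← Real.rpow_add two_pos]
  congr 1
  ring

theorem wigner_tau {k : ℕ} (n : ℝ) (σ : Op k) (v : Phase k) (w : Phase 1) :
    wigner (tau n σ) (phaseAppend v w) =
      if w.1 0 = 0 then tauWeight k n / 2 else failWeight k n * wigner σ v / 2 := by
  rw [tau, wigner_flagged, wigner_maxMixed]
  rfl

/-! ### Rényi divergences of Wigner representations -/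

theorem one_lt_toReal_of_mem_orders {α : ℝ≥0∞} (hα : α ∈ orders) (h : α ≠ ⊤) : 1 < α.toReal := by
  rcases hα with ⟨a, b, hb, hab, rfl⟩ | h'
  · have hb' : (1 : ℝ) ≤ b := by exact_mod_cast hb
    have hab' : (b : ℝ) ≤ a := by exact_mod_cast hab
    have h1 : 1 < 2 * (a : ℝ) / (2 * (b : ℝ) - 1) := by
      rw [lt_div_iff₀ (by linarith)]
      linarith
    rwa [ENNReal.toReal_ofReal (by linarith)]
  · exact absurd h' h

theorem log2_ofReal {x : ℝ} (hx : 0 < x) : log2 (ENNReal.ofReal x) = (Real.logb 2 x : EReal) := by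
  rw [log2, ENNReal.log_ofReal_of_pos hx, ← EReal.coe_div]
  rfl

theorem logb_two_four : Real.logb 2 4 = 2 := by
  rw [show (4 : ℝ) = 2 ^ (2 : ℝ) by norm_num, Real.logb_rpow two_pos (by norm_num)]

theorem log2_top : log2 ⊤ = ⊤ := by
  rw [log2, ENNReal.log_top]
  exact EReal.top_div_of_pos_ne_top (EReal.coe_pos.2 (Real.log_pos one_lt_two)) (EReal.coe_ne_top _)

theorem sum_phase_one {R : Type*} [AddCommMonoid R] (g : ZMod 2 → R) :
    ∑ w : Phase 1, g (w.1 0) = 2 • (g 0 + g 1) := by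
  rw [Fintype.sum_prod_type]
  simp only [Finset.sum_const, Finset.card_univ, card_bits, pow_one, ← Finset.smul_sum]
  congr 1
  rw [← Equiv.sum_comp (Equiv.funUnique (Fin 1) (ZMod 2)).symm]
  exact Fin.sum_univ_two _

/-- A vector with nonzero sum has a positive `α`-power sum. -/
theorem sum_rpow_pos {ι : Type*} [Fintype ι] {x : ι → ℝ} (hx : ∑ i, x i ≠ 0) (α : ℝ) :
    0 < ∑ i, |x i| ^ α := by
  obtain ⟨i, -, hi⟩ := Finset.exists_ne_zero_of_sum_ne_zero hx
  exact Finset.sum_pos' (fun j _ => by positivity) ⟨i, Finset.mem_univ i, by positivity⟩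

theorem iSup_abs_pos {ι : Type*} [Fintype ι] {x : ι → ℝ} (hx : ∑ i, x i ≠ 0) :
    0 < ⨆ i, |x i| := by
  obtain ⟨i, -, hi⟩ := Finset.exists_ne_zero_of_sum_ne_zero hx
  exact lt_of_lt_of_le (abs_pos.2 hi) (le_ciSup (Set.finite_range fun i => |x i|).bddAbove i)

theorem iSup_ofReal {ι : Type*} [Finite ι] [Nonempty ι] (f : ι → ℝ) :
    ⨆ i, ENNReal.ofReal (f i) = ENNReal.ofReal (⨆ i, f i) := by
  refine le_antisymm (iSup_le fun i =>
    ENNReal.ofReal_le_ofReal (le_ciSup (Set.finite_range f).bddAbove i)) ?_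
  obtain ⟨i, hi⟩ := exists_eq_ciSup_of_finite (f := f)
  rw [← hi]
  exact le_iSup (fun i => ENNReal.ofReal (f i)) i

theorem ofReal_abs_rpow_mul_rpow {α : ℝ} (hα : 1 < α) (y : ℝ) {r : ℝ} (hr : 0 < r) :
    ENNReal.ofReal |y| ^ α * ENNReal.ofReal r ^ (1 - α) =
      ENNReal.ofReal (|y| ^ α * r ^ (1 - α)) := by
  rw [ENNReal.ofReal_rpow_of_nonneg (abs_nonneg y) (by linarith), ENNReal.ofReal_rpow_of_pos hr,
    ENNReal.ofReal_mul (by positivity)]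

/-- The divergence of the input state from the maximally mixed state is its entropy deficit. -/
theorem renyiDiv_maxMixed {α : ℝ≥0∞} (hα : α ∈ orders) {ρ : Op 1} (hρ : ρ.trace = 1) :
    renyiDiv α (wigner ρ) (wigner (maxMixed 1)) = ((2 - renyiEntropy α (wigner ρ) : ℝ) : EReal) := by
  have hsum : ∑ u, wigner ρ u ≠ 0 := by
    rw [sum_wigner hρ]
    exact one_ne_zero
  simp only [renyiDiv, renyiEntropy, wigner_maxMixed, pow_one]
  split_ifs with h
  · have h1 : ∀ u, ENNReal.ofReal |wigner ρ u| / ENNReal.ofReal (4 : ℝ)⁻¹ =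
        ENNReal.ofReal |wigner ρ u| * ENNReal.ofReal 4 := by
      intro u
      rw [ENNReal.ofReal_inv_of_pos four_pos, div_eq_mul_inv, inv_inv]
    simp only [h1]
    rw [← ENNReal.iSup_mul, iSup_ofReal, ← ENNReal.ofReal_mul (iSup_abs_pos hsum).le,
      log2_ofReal (mul_pos (iSup_abs_pos hsum) four_pos),
      Real.logb_mul (iSup_abs_pos hsum).ne' four_ne_zero, logb_two_four]
    congr 1
    ring
  · have h1 := one_lt_toReal_of_mem_orders hα h
    have hS := sum_rpow_pos hsum α.toReal
    simp only [ofReal_abs_rpow_mul_rpow h1 _ (inv_pos.2 (four_pos (α := ℝ)))]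
    rw [← ENNReal.ofReal_sum_of_nonneg fun i _ => by positivity, ← Finset.sum_mul,
      log2_ofReal (by positivity), ← EReal.coe_mul, Real.logb_mul hS.ne' (by positivity),
      Real.logb_rpow_eq_mul_logb_of_pos (by positivity), Real.logb_inv, logb_two_four]
    congr 1
    have h2 : α.toReal - 1 ≠ 0 := by linarith
    have h3 : 1 - α.toReal ≠ 0 := by linarith
    field_simp
    ring

/-- The Rényi sum of a flagged quasi-distribution, for finite order. -/
theorem sum_flagged {ι : Type*} [Fintype ι] {α : ℝ} (hα : 1 < α) (y s : ι → ℝ) {r q f : ℝ}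
    (hr : 0 < r) (hs0 : ∀ v, 0 ≤ s v) (hs1 : ∑ v, s v = 1) (hq : 0 ≤ q) (hf : 0 ≤ f)
    (hqf : q = 0 ∨ 0 < f) :
    ∑ v, ∑ w : Phase 1,
      ENNReal.ofReal |if w.1 0 = 0 then y v / 2 else q * s v / 2| ^ α *
        ENNReal.ofReal (if w.1 0 = 0 then r / 2 else f * s v / 2) ^ (1 - α) =
      ENNReal.ofReal (∑ v, |y v| ^ α * r ^ (1 - α) + q ^ α * f ^ (1 - α)) := by
  have h22 : (2 : ℝ) ^ α * 2 ^ (1 - α) = 2 := by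
    rw [← Real.rpow_add two_pos]
    norm_num
  have h1 : ∀ v, ENNReal.ofReal |y v / 2| ^ α * ENNReal.ofReal (r / 2) ^ (1 - α) =
      ENNReal.ofReal (|y v| ^ α * r ^ (1 - α) / 2) := by
    intro v
    rw [ofReal_abs_rpow_mul_rpow hα _ (by positivity), abs_div, abs_two,
      Real.div_rpow (abs_nonneg _) zero_le_two, Real.div_rpow hr.le zero_le_two, div_mul_div_comm,
      h22]
  have h2 : ∀ v, ENNReal.ofReal |q * s v / 2| ^ α * ENNReal.ofReal (f * s v / 2) ^ (1 - α) =
      ENNReal.ofReal (q ^ α * f ^ (1 - α) * s v / 2) := by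
    intro v
    have hα0 : 0 < α := by linarith
    -- where `s v = 0` the power of zero with negative exponent is `⊤`, but it is multiplied by `0`
    rcases (hs0 v).eq_or_lt with h | h
    · simp [← h, ENNReal.zero_rpow_of_pos hα0]
    rcases hqf with rfl | hf
    · simp [ENNReal.zero_rpow_of_pos hα0, Real.zero_rpow hα0.ne']
    have hss : s v ^ α * s v ^ (1 - α) = s v := by
      rw [← Real.rpow_add h]
      norm_num
    rw [ofReal_abs_rpow_mul_rpow hα _ (by positivity), abs_of_nonneg (by positivity),
      Real.div_rpow (by positivity) zero_le_two, Real.div_rpow (by positivity) zero_le_two,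
      div_mul_div_comm, h22, Real.mul_rpow hq h.le, Real.mul_rpow hf.le h.le, mul_mul_mul_comm, hss]
  have h3 : ∀ v, ∑ w : Phase 1,
      ENNReal.ofReal |if w.1 0 = 0 then y v / 2 else q * s v / 2| ^ α *
        ENNReal.ofReal (if w.1 0 = 0 then r / 2 else f * s v / 2) ^ (1 - α) =
      ENNReal.ofReal (|y v| ^ α * r ^ (1 - α) + q ^ α * f ^ (1 - α) * s v) := by
    intro v
    rw [sum_phase_one (fun x => ENNReal.ofReal |if x = 0 then y v / 2 else q * s v / 2| ^ α *
        ENNReal.ofReal (if x = 0 then r / 2 else f * s v / 2) ^ (1 - α))]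
    simp only [if_true, one_ne_zero, if_false]
    have hsv := hs0 v
    rw [h1, h2, ← ENNReal.ofReal_add (by positivity) (by positivity), ← ENNReal.ofReal_nsmul]
    congr 1
    rw [nsmul_eq_mul]
    push_cast
    ring
  simp only [h3]
  rw [← ENNReal.ofReal_sum_of_nonneg fun v _ =>
    add_nonneg (by positivity) (mul_nonneg (by positivity) (hs0 v)),
    Finset.sum_add_distrib, ← Finset.mul_sum, hs1, mul_one]

/-- The Rényi sum of a flagged quasi-distribution, for infinite order. -/
theorem iSup_flagged {ι : Type*} [Fintype ι] [Nonempty ι] (y s : ι → ℝ) {r q f : ℝ}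
    (hr : 0 < r) (hs0 : ∀ v, 0 ≤ s v) (hs1 : ∑ v, s v = 1) (hq : 0 ≤ q)
    (hqf : q = 0 ∨ 0 < f) :
    ⨆ z : ι × Phase 1, ENNReal.ofReal |if z.2.1 0 = 0 then y z.1 / 2 else q * s z.1 / 2| /
        ENNReal.ofReal (if z.2.1 0 = 0 then r / 2 else f * s z.1 / 2) =
      ENNReal.ofReal (max ((⨆ v, |y v|) / r) (q / f)) := by
  have h1 : ∀ v, ENNReal.ofReal |y v / 2| / ENNReal.ofReal (r / 2) = ENNReal.ofReal (|y v| / r) := by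
    intro v
    rw [← ENNReal.ofReal_div_of_pos (by positivity), abs_div, abs_two,
      div_div_div_cancel_right₀ two_ne_zero]
  have h2 : ∀ v, 0 < s v → ENNReal.ofReal |q * s v / 2| / ENNReal.ofReal (f * s v / 2) =
      ENNReal.ofReal (q / f) := by
    intro v h
    rcases hqf with rfl | hf
    · simp
    rw [← ENNReal.ofReal_div_of_pos (by positivity), abs_of_nonneg (by positivity),
      div_div_div_cancel_right₀ two_ne_zero, mul_div_mul_right _ _ h.ne']
  refine le_antisymm (iSup_le ?_) ?_
  · rintro ⟨v, w⟩
    dsimp only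
    split_ifs
    · rw [h1]
      refine ENNReal.ofReal_le_ofReal (le_max_of_le_left ?_)
      gcongr
      exact le_ciSup (Set.finite_range fun v => |y v|).bddAbove v
    · rcases (hs0 v).eq_or_lt with h | h
      · simp [← h]
      · rw [h2 v h]
        exact ENNReal.ofReal_le_ofReal (le_max_right _ _)
  · rw [ENNReal.ofReal_max]
    refine max_le ?_ ?_
    · obtain ⟨v, hv⟩ := exists_eq_ciSup_of_finite (f := fun v => |y v|)
      rw [← hv, ← h1]
      exact le_iSup_of_le (v, (0, 0)) (by simp)
    · obtain ⟨v, -, hv⟩ := Finset.exists_ne_zero_of_sum_ne_zero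
        (hs1.symm ▸ one_ne_zero : ∑ v, s v ≠ 0)
      rw [← h2 v (lt_of_le_of_ne (hs0 v) (Ne.symm hv))]
      exact le_iSup_of_le (v, (1, 0)) (by simp)

section Flagged

variable {k : ℕ} {ρ' σ : Op k} {p n : ℝ} {α : ℝ≥0∞}

theorem renyiDiv_rhoP_tau_of_ne_top (hα : α ∈ orders) (htop : α ≠ ⊤) (hσ : σ ∈ cssStates k)
    (hp1 : p ≤ 1) (hn : (k : ℝ) ≤ n) (h : 1 - p = 0 ∨ (k : ℝ) < n)
    (hpos : 0 < ∑ v, |p * wigner ρ' v| ^ α.toReal * tauWeight k n ^ (1 - α.toReal) +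
      (1 - p) ^ α.toReal * failWeight k n ^ (1 - α.toReal)) :
    renyiDiv α (wigner (rhoP p ρ' σ)) (wigner (tau n σ)) =
      (((α.toReal - 1)⁻¹ * Real.logb 2
        (∑ v, |p * wigner ρ' v| ^ α.toReal * tauWeight k n ^ (1 - α.toReal) +
          (1 - p) ^ α.toReal * failWeight k n ^ (1 - α.toReal)) : ℝ) : EReal) := by
  rw [renyiDiv, if_neg htop, sum_phaseAppend]
  simp only [wigner_rhoP, wigner_tau]
  rw [sum_flagged (one_lt_toReal_of_mem_orders hα htop) (fun v => p * wigner ρ' v) (wigner σ)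
    (tauWeight_pos k n) (wigner_nonneg_of_mem_cssStates hσ) (sum_wigner (cssStates_subset k hσ).2)
    (sub_nonneg.2 hp1) (failWeight_nonneg hn) (h.imp_right failWeight_pos), log2_ofReal hpos,
    EReal.coe_mul]

theorem renyiDiv_rhoP_tau_top (hσ : σ ∈ cssStates k) (hp1 : p ≤ 1)
    (h : 1 - p = 0 ∨ (k : ℝ) < n)
    (hpos : 0 < max ((⨆ v, |p * wigner ρ' v|) / tauWeight k n) ((1 - p) / failWeight k n)) :
    renyiDiv ⊤ (wigner (rhoP p ρ' σ)) (wigner (tau n σ)) =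
      (Real.logb 2 (max ((⨆ v, |p * wigner ρ' v|) / tauWeight k n)
        ((1 - p) / failWeight k n)) : EReal) := by
  rw [renyiDiv, if_pos rfl, ← Equiv.iSup_comp (phaseEquiv k 1)]
  simp only [phaseEquiv_apply, wigner_rhoP, wigner_tau]
  rw [iSup_flagged (fun v => p * wigner ρ' v) (wigner σ) (tauWeight_pos k n)
    (wigner_nonneg_of_mem_cssStates hσ) (sum_wigner (cssStates_subset k hσ).2)
    (sub_nonneg.2 hp1) (h.imp_right failWeight_pos), log2_ofReal hpos]

/-- For `n = k` the failing branch is missing from `τ_{n,k}`, so that the divergence is infinite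
unless the projection never fails. -/
theorem renyiDiv_rhoP_tau_self (hα : α ∈ orders) (hσ : σ ∈ cssStates k) (hp : p < 1) :
    renyiDiv α (wigner (rhoP p ρ' σ)) (wigner (tau (k : ℝ) σ)) = ⊤ := by
  obtain ⟨v, -, hv⟩ := Finset.exists_ne_zero_of_sum_ne_zero
    ((sum_wigner (cssStates_subset k hσ).2).symm ▸ one_ne_zero : ∑ v, wigner σ v ≠ 0)
  have hw : wigner (rhoP p ρ' σ) (phaseAppend v (1, 0)) ≠ 0 := by
    rw [wigner_rhoP]
    simpa using ⟨sub_ne_zero.2 hp.ne', hv⟩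
  have hw' : ENNReal.ofReal |wigner (rhoP p ρ' σ) (phaseAppend v (1, 0))| ≠ 0 := by
    simpa using hw
  have hr : wigner (tau (k : ℝ) σ) (phaseAppend v (1, 0)) = 0 := by
    rw [wigner_tau, failWeight_self]
    simp
  rw [renyiDiv]
  split_ifs with htop
  · have h1 : (⨆ i, ENNReal.ofReal |wigner (rhoP p ρ' σ) i| /
        ENNReal.ofReal (wigner (tau (k : ℝ) σ) i)) = ⊤ := by
      refine top_le_iff.1 (le_trans (le_of_eq ?_) (le_iSup _ (phaseAppend v (1, 0))))
      rw [hr, ENNReal.ofReal_zero, ENNReal.div_zero hw']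
    rw [h1, log2_top]
  · have hα1 := one_lt_toReal_of_mem_orders hα htop
    have h1 : (∑ i, ENNReal.ofReal |wigner (rhoP p ρ' σ) i| ^ α.toReal *
        ENNReal.ofReal (wigner (tau (k : ℝ) σ) i) ^ (1 - α.toReal)) = ⊤ := by
      refine ENNReal.sum_eq_top.2 ⟨phaseAppend v (1, 0), Finset.mem_univ _, ?_⟩
      rw [hr, ENNReal.ofReal_zero, ENNReal.zero_rpow_of_neg (by linarith), ENNReal.mul_top]
      exact (ENNReal.rpow_pos (pos_iff_ne_zero.2 hw') ENNReal.ofReal_ne_top).ne'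
    rw [h1, log2_top, EReal.coe_mul_top_of_pos (inv_pos.2 (by linarith))]

end Flagged

/-! ### Monotonicity of Rényi sums under stochastic maps -/

/-- Jensen's inequality for the row `s` of a stochastic matrix acting on the pair `(w, q)`. -/
theorem abs_sum_rpow_mul_rpow_le {ι : Type*} [Fintype ι] {α : ℝ} (hα : 1 < α) {s w q : ι → ℝ}
    (hs : ∀ u, 0 ≤ s u) (hq : ∀ u, 0 < q u) :
    |∑ u, s u * w u| ^ α * (∑ u, s u * q u) ^ (1 - α) ≤
      ∑ u, s u * (|w u| ^ α * q u ^ (1 - α)) := by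
  have hα0 : 0 < α := by linarith
  have hsq : ∀ u, 0 ≤ s u * q u := fun u => mul_nonneg (hs u) (hq u).le
  rcases (Finset.sum_nonneg fun u _ => hsq u : 0 ≤ ∑ u, s u * q u).eq_or_lt with h0 | hR
  · have h1 : ∀ u, s u = 0 := by
      intro u
      have h2 := (Finset.sum_eq_zero_iff_of_nonneg fun u _ => hsq u).1 h0.symm u (Finset.mem_univ u)
      exact (mul_eq_zero.1 h2).resolve_right (hq u).ne'
    simp [h1, Real.zero_rpow hα0.ne']
  set R := ∑ u, s u * q u
  have hJ := Real.rpow_arith_mean_le_arith_mean_rpow Finset.univ (fun u => s u * q u / R)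
    (fun u => |w u| / q u) (fun u _ => div_nonneg (hsq u) hR.le)
    (by rw [← Finset.sum_div]; exact div_self hR.ne')
    (fun u _ => div_nonneg (abs_nonneg _) (hq u).le) hα.le
  have h1 : |∑ u, s u * w u| / R ≤ ∑ u, s u * q u / R * (|w u| / q u) := by
    have h2 : ∑ u, s u * q u / R * (|w u| / q u) = (∑ u, |s u * w u|) / R := by
      rw [Finset.sum_div]
      refine Finset.sum_congr rfl fun u _ => ?_
      rw [abs_mul, abs_of_nonneg (hs u)]
      have := (hq u).ne'
      field_simp
    rw [h2]
    gcongr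
    exact Finset.abs_sum_le_sum_abs _ _
  have h3 := (Real.rpow_le_rpow (by positivity) h1 hα0.le).trans hJ
  have hR1 : R * R ^ (-α) = R ^ (1 - α) := by
    rw [sub_eq_add_neg, Real.rpow_add hR, Real.rpow_one]
  calc |∑ u, s u * w u| ^ α * R ^ (1 - α) = R * (|∑ u, s u * w u| / R) ^ α := by
        rw [Real.div_rpow (abs_nonneg _) hR.le, ← hR1, Real.rpow_neg hR.le]
        ring
    _ ≤ R * ∑ u, s u * q u / R * (|w u| / q u) ^ α := by gcongr
    _ = ∑ u, s u * (|w u| ^ α * q u ^ (1 - α)) := by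
        rw [Finset.mul_sum]
        refine Finset.sum_congr rfl fun u _ => ?_
        rw [Real.div_rpow (abs_nonneg _) (hq u).le, sub_eq_add_neg, Real.rpow_add (hq u),
          Real.rpow_one, Real.rpow_neg (hq u).le]
        field_simp

/-- The limit of `abs_sum_rpow_mul_rpow_le` for infinite order. -/
theorem abs_sum_le_mul_sum {ι : Type*} [Fintype ι] {s w q : ι → ℝ} {C : ℝ} (hs : ∀ u, 0 ≤ s u)
    (h : ∀ u, |w u| ≤ C * q u) : |∑ u, s u * w u| ≤ C * ∑ u, s u * q u := by
  rw [Finset.mul_sum]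
  refine (Finset.abs_sum_le_sum_abs _ _).trans (Finset.sum_le_sum fun u _ => ?_)
  rw [abs_mul, abs_of_nonneg (hs u), mul_left_comm]
  exact mul_le_mul_of_nonneg_left (h u) (hs u)

/-! ### The Wigner representation of many copies -/

theorem wigner_tensorPow {ρ : Op 1} (hρ : ∀ i j, (ρ i j).im = 0) (n : ℕ) (u : Phase n) :
    wigner (tensorPow ρ n) u = ∏ i, wigner ρ (fun _ => u.1 i, fun _ => u.2 i) := by
  rw [wigner, wignerC_tensorPow]
  simp only [← ofReal_wigner hρ]
  rw [← Complex.ofReal_prod, Complex.ofReal_re]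

theorem sum_prod_phase {n : ℕ} (f : Phase 1 → ℝ) :
    ∑ u : Phase n, ∏ i, f (fun _ => u.1 i, fun _ => u.2 i) = (∑ u, f u) ^ n := by
  have h1 : ∑ u, f u = ∑ x : ZMod 2 × ZMod 2, f (fun _ => x.1, fun _ => x.2) := by
    rw [← Equiv.sum_comp ((Equiv.funUnique (Fin 1) (ZMod 2)).prodCongr
      (Equiv.funUnique (Fin 1) (ZMod 2))).symm]
    rfl
  rw [h1, Fintype.sum_pow, ← Equiv.sum_comp (Equiv.arrowProdEquivProdArrow _ _ _)]
  rfl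

theorem sum_wigner_tensorPow_rpow {ρ : Op 1} (hρ : ∀ i j, (ρ i j).im = 0) (n : ℕ) (α : ℝ) :
    ∑ u, |wigner (tensorPow ρ n) u| ^ α = (∑ u, |wigner ρ u| ^ α) ^ n := by
  rw [← sum_prod_phase]
  refine Finset.sum_congr rfl fun u _ => ?_
  rw [wigner_tensorPow hρ, Finset.abs_prod, Real.finsetProd_rpow _ _ fun i _ => abs_nonneg _]

theorem abs_wigner_tensorPow_le {ρ : Op 1} (hρ : ∀ i j, (ρ i j).im = 0) (n : ℕ) (u : Phase n) :
    |wigner (tensorPow ρ n) u| ≤ (⨆ v, |wigner ρ v|) ^ n := by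
  rw [wigner_tensorPow hρ, Finset.abs_prod]
  refine (Finset.prod_le_prod (fun i _ => abs_nonneg _) fun i _ =>
    le_ciSup (Set.finite_range fun v => |wigner ρ v|).bddAbove _).trans ?_
  simp

theorem sum_wigner_tensorPow {ρ : Op 1} (hρ : IsRebitState ρ) (n : ℕ) :
    ∑ u, wigner (tensorPow ρ n) u = 1 := by
  have h : ∀ u : Phase n, wigner (tensorPow ρ n) u = _ := wigner_tensorPow hρ.2 n
  simp only [h]
  rw [sum_prod_phase, sum_wigner hρ.1.2, one_pow]

/-! ### Distillation by code projections -/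

section Distillation

variable {k m : ℕ} {ρ : Op 1} {ρ' : Op k} {p : ℝ}

/-- A code projection that distils `ρ'` gives a stochastic matrix, with the rows `T v` for the
succeeding branch and one row `t` for the failing one, that maps the input state and the maximally
mixed state to the flagged states `ρ_p` and `τ_{n,k}`. -/
theorem CSSCodeProjection.exists_stochastic (K : CSSCodeProjection k m) (hρ : IsRebitState ρ)
    (hρ' : IsRebitState ρ') (hK : K.apply (tensorPow ρ (k + m)) = (p : ℂ) • ρ') :
    ∃ (T : Phase k → Phase (k + m) → ℝ) (t : Phase (k + m) → ℝ),
      (∀ v u, 0 ≤ T v u) ∧ (∀ u, 0 ≤ t u) ∧ (∀ u, ∑ v, T v u + t u = 1) ∧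
      (∀ v, p * wigner ρ' v = ∑ u, T v u * wigner (tensorPow ρ (k + m)) u) ∧
      1 - p = ∑ u, t u * wigner (tensorPow ρ (k + m)) u ∧
      (∀ v, tauWeight k (k + m : ℕ) = ∑ u, T v u * ((4 : ℝ) ^ (k + m))⁻¹) ∧
      failWeight k (k + m : ℕ) = ∑ u, t u * ((4 : ℝ) ^ (k + m))⁻¹ := by
  obtain ⟨T, hT0, hT1, hT⟩ := K.wignerSubstochastic
  have hin : ∀ i j, (tensorPow ρ (k + m) i j).im = 0 := by
    intro i j
    have h : ∀ i, ρ (fun _ => i) = fun j => (((ρ (fun _ => i) j).re : ℝ) : ℂ) := fun i =>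
      funext fun j => (Complex.ext rfl (hρ.2 _ j))
    have h2 : tensorPow ρ (k + m) i j =
        ((∏ l, (ρ (fun _ => i l) (fun _ => j l)).re : ℝ) : ℂ) := by
      rw [Complex.ofReal_prod]
      exact Finset.prod_congr rfl fun l _ => congrFun (h (i l)) _
    rw [h2, Complex.ofReal_im]
  have hw : ∀ v, p * wigner ρ' v = ∑ u, T v u * wigner (tensorPow ρ (k + m)) u := by
    intro v
    have h := hT (tensorPow ρ (k + m)) v
    rw [hK, wignerC_smul, ← ofReal_wigner hρ'.2] at h
    simp only [← ofReal_wigner hin] at h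
    exact_mod_cast h
  have hr : ∀ v, tauWeight k (k + m : ℕ) = ∑ u, T v u * ((4 : ℝ) ^ (k + m))⁻¹ := by
    intro v
    have h := hT (maxMixed (k + m)) v
    rw [K.apply_maxMixed, wignerC_smul, wignerC_one] at h
    simp only [wignerC_maxMixed] at h
    have h2 : tauWeight k (k + m : ℕ) = ((2 : ℝ) ^ (k + m))⁻¹ * ((2 : ℝ) ^ k)⁻¹ := by
      rw [tauWeight_eq, Real.rpow_neg zero_le_two, Real.rpow_add two_pos, Real.rpow_natCast,
        Real.rpow_natCast, mul_inv]
    rw [h2]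
    apply Complex.ofReal_injective
    push_cast
    exact h
  have hcard : (Fintype.card (Phase (k + m)) : ℝ) * ((4 : ℝ) ^ (k + m))⁻¹ = 1 := by
    rw [card_phase]
    push_cast
    exact mul_inv_cancel₀ (by positivity)
  -- the failing branch takes up what the columns of `T` lack
  refine ⟨T, fun u => 1 - ∑ v, T v u, hT0, fun u => sub_nonneg.2 (hT1 u),
    fun u => add_sub_cancel _ _, hw, ?_, hr, ?_⟩
  · simp only [sub_mul, one_mul, Finset.sum_sub_distrib, sum_wigner_tensorPow hρ, Finset.sum_mul]
    rw [Finset.sum_comm]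
    simp only [← hw]
    rw [← Finset.mul_sum, sum_wigner hρ'.1.2, mul_one]
  · simp only [sub_mul, one_mul, Finset.sum_sub_distrib, Finset.sum_mul]
    rw [Finset.sum_comm]
    simp only [← hr]
    rw [Finset.sum_const, Finset.sum_const, nsmul_eq_mul, nsmul_eq_mul, Finset.card_univ,
      Finset.card_univ, hcard, card_phase, tauWeight, failWeight]
    push_cast
    field_simp

/-- A code projection without syndrome qubits always succeeds. -/
theorem CSSCodeProjection.eq_one_or_lt (K : CSSCodeProjection k m) (hρ : IsRebitState ρ)
    (hρ' : IsRebitState ρ') (hK : K.apply (tensorPow ρ (k + m)) = (p : ℂ) • ρ') :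
    1 - p = 0 ∨ (k : ℝ) < (k + m : ℕ) := by
  rcases Nat.eq_zero_or_pos m with rfl | hm
  · left
    obtain ⟨T, t, -, ht, -, -, h1, -, h2⟩ := K.exists_stochastic hρ hρ' hK
    have h3 : failWeight k (k + 0 : ℕ) = 0 := failWeight_self k
    rw [h3, eq_comm,
      Finset.sum_eq_zero_iff_of_nonneg fun u _ => mul_nonneg (ht u) (by positivity)] at h2
    rw [h1]
    refine Finset.sum_eq_zero fun u hu => ?_
    rw [(mul_eq_zero.1 (h2 u hu)).resolve_right (by positivity), zero_mul]
  · right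
    exact_mod_cast Nat.lt_add_of_pos_right hm

theorem CSSCodeProjection.renyiSum_le (K : CSSCodeProjection k m) (hρ : IsRebitState ρ)
    (hρ' : IsRebitState ρ') (hp1 : p ≤ 1)
    (hK : K.apply (tensorPow ρ (k + m)) = (p : ℂ) • ρ') {α : ℝ} (hα : 1 < α) :
    ∑ v, |p * wigner ρ' v| ^ α * tauWeight k (k + m : ℕ) ^ (1 - α) +
      (1 - p) ^ α * failWeight k (k + m : ℕ) ^ (1 - α) ≤
      (∑ u, |wigner ρ u| ^ α) ^ (k + m) * (((4 : ℝ) ^ (k + m))⁻¹) ^ (1 - α) := by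
  obtain ⟨T, t, hT, ht, hTt, h1, h2, h3, h4⟩ := K.exists_stochastic hρ hρ' hK
  have hq : ∀ _ : Phase (k + m), 0 < ((4 : ℝ) ^ (k + m))⁻¹ := fun _ => by positivity
  have hacc : ∀ v, |p * wigner ρ' v| ^ α * tauWeight k (k + m : ℕ) ^ (1 - α) ≤
      ∑ u, T v u * (|wigner (tensorPow ρ (k + m)) u| ^ α * (((4 : ℝ) ^ (k + m))⁻¹) ^ (1 - α)) := by
    intro v
    rw [h1, h3 v]
    exact abs_sum_rpow_mul_rpow_le hα (hT v) hq
  have hrej : (1 - p) ^ α * failWeight k (k + m : ℕ) ^ (1 - α) ≤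
      ∑ u, t u * (|wigner (tensorPow ρ (k + m)) u| ^ α * (((4 : ℝ) ^ (k + m))⁻¹) ^ (1 - α)) := by
    rw [← abs_of_nonneg (sub_nonneg.2 hp1), h2, h4]
    exact abs_sum_rpow_mul_rpow_le hα ht hq
  refine (add_le_add (Finset.sum_le_sum fun v _ => hacc v) hrej).trans (le_of_eq ?_)
  rw [Finset.sum_comm, ← Finset.sum_add_distrib, ← sum_wigner_tensorPow_rpow hρ.2, Finset.sum_mul]
  refine Finset.sum_congr rfl fun u _ => ?_
  rw [← Finset.sum_mul, ← add_mul, hTt, one_mul]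

theorem CSSCodeProjection.renyiMax_le (K : CSSCodeProjection k m) (hρ : IsRebitState ρ)
    (hρ' : IsRebitState ρ') (hp1 : p ≤ 1)
    (hK : K.apply (tensorPow ρ (k + m)) = (p : ℂ) • ρ') :
    max ((⨆ v, |p * wigner ρ' v|) / tauWeight k (k + m : ℕ)) ((1 - p) / failWeight k (k + m : ℕ)) ≤
      ((⨆ u, |wigner ρ u|) * 4) ^ (k + m) := by
  obtain ⟨T, t, hT, ht, hTt, h1, h2, h3, h4⟩ := K.exists_stochastic hρ hρ' hK
  have hM : 0 ≤ ⨆ u, |wigner ρ u| := Real.iSup_nonneg fun u => abs_nonneg _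
  have hw : ∀ u : Phase (k + m), |wigner (tensorPow ρ (k + m)) u| ≤
      ((⨆ u, |wigner ρ u|) * 4) ^ (k + m) * ((4 : ℝ) ^ (k + m))⁻¹ := by
    intro u
    rw [mul_pow, mul_inv_cancel_right₀ (by positivity)]
    exact abs_wigner_tensorPow_le hρ.2 _ u
  refine max_le ?_ ?_
  · rw [div_le_iff₀ (tauWeight_pos k _)]
    refine ciSup_le fun v => ?_
    rw [h1, h3 v]
    exact abs_sum_le_mul_sum (hT v) hw
  · refine div_le_of_le_mul₀ (failWeight_nonneg (by exact_mod_cast Nat.le_add_right k m))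
      (by positivity) ?_
    rw [← abs_of_nonneg (sub_nonneg.2 hp1), h2, h4]
    exact abs_sum_le_mul_sum ht hw

end Distillation

/-- The divergence of `ρ_p` from `τ_{n,k}` is a `flaggedDiv`, and monotonicity under the stochastic
matrix of a code projection bounds it by `n` times the divergence of `ρ` from the maximally mixed
state. -/
theorem exists_flaggedDiv {k : ℕ} {ρ : Op 1} (hρ : IsRebitState ρ) {ρ' : Op k}
    (hρ' : IsRebitState ρ') {p : ℝ} (hp0 : 0 < p) (hp1 : p ≤ 1) {σ : Op k} (hσ : σ ∈ cssStates k)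
    {α : ℝ≥0∞} (hα : α ∈ orders) :
    ∃ (φ : ℝ → ℝ → ℝ) (e A B : ℝ), IsRenyiSum φ ∧ 0 < e ∧ 0 < A ∧ 0 ≤ B ∧ (B = 0 ↔ 1 - p = 0) ∧
      (∀ n : ℝ, (k : ℝ) ≤ n → (1 - p = 0 ∨ (k : ℝ) < n) →
        renyiDiv α (wigner (rhoP p ρ' σ)) (wigner (tau n σ)) =
          (flaggedDiv φ k e A B n : EReal)) ∧
      ∀ (m : ℕ) (K : CSSCodeProjection k m), K.apply (tensorPow ρ (k + m)) = (p : ℂ) • ρ' →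
        flaggedDiv φ k e A B (k + m : ℕ) ≤ (k + m : ℕ) * (2 - renyiEntropy α (wigner ρ)) := by
  have hsum : ∑ v, p * wigner ρ' v ≠ 0 := by
    rw [← Finset.mul_sum, sum_wigner hρ'.1.2, mul_one]
    exact hp0.ne'
  have hsum1 : ∑ v, wigner ρ v ≠ 0 := by
    rw [sum_wigner hρ.1.2]
    exact one_ne_zero
  have hle : ∀ m : ℕ, (k : ℝ) ≤ (k + m : ℕ) := fun m => by exact_mod_cast Nat.le_add_right k m
  by_cases htop : α = ⊤
  · subst htop
    have hA : 0 < (⨆ v, |p * wigner ρ' v|) * (2 : ℝ) ^ (k : ℝ) :=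
      mul_pos (iSup_abs_pos hsum) (by positivity)
    have hF : ∀ n, flaggedSum max k 1 ((⨆ v, |p * wigner ρ' v|) * (2 : ℝ) ^ (k : ℝ)) (1 - p) n =
        max ((⨆ v, |p * wigner ρ' v|) / tauWeight k n) ((1 - p) / failWeight k n) := by
      intro n
      rw [flaggedSum, Real.rpow_neg_one, tauWeight_eq, Real.rpow_neg zero_le_two, div_inv_eq_mul,
        mul_assoc, ← Real.rpow_add two_pos, mul_one, add_comm n, div_eq_mul_inv (1 - p)]
    refine ⟨max, 1, _, 1 - p, isRenyiSum_max, one_pos, hA, sub_nonneg.2 hp1, Iff.rfl,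
      fun n hn h => ?_, fun m K hK => ?_⟩
    · have hpos := flaggedSum_pos (e := 1) isRenyiSum_max hA (sub_nonneg.2 hp1) hn
      rw [hF] at hpos
      rw [renyiDiv_rhoP_tau_top hσ hp1 h hpos, flaggedDiv, hF, inv_one, one_mul]
    · have hpos := flaggedSum_pos (e := 1) isRenyiSum_max hA (sub_nonneg.2 hp1) (hle m)
      have hM := iSup_abs_pos hsum1
      rw [hF] at hpos
      rw [flaggedDiv, hF, inv_one, one_mul]
      refine (Real.logb_le_logb_of_le one_lt_two hpos (K.renyiMax_le hρ hρ' hp1 hK)).trans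
        (le_of_eq ?_)
      rw [Real.logb_pow, Real.logb_mul hM.ne' four_ne_zero, logb_two_four, renyiEntropy, if_pos rfl]
      ring
  · have hα1 := one_lt_toReal_of_mem_orders hα htop
    have hA : 0 < (∑ v, |p * wigner ρ' v| ^ α.toReal) * (2 : ℝ) ^ (k * (α.toReal - 1)) :=
      mul_pos (sum_rpow_pos hsum _) (by positivity)
    have hB : 0 ≤ (1 - p) ^ α.toReal := Real.rpow_nonneg (sub_nonneg.2 hp1) _
    have hF : ∀ n, flaggedSum (fun x y => x + y) k (α.toReal - 1)
        ((∑ v, |p * wigner ρ' v| ^ α.toReal) * (2 : ℝ) ^ (k * (α.toReal - 1)))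
        ((1 - p) ^ α.toReal) n =
        ∑ v, |p * wigner ρ' v| ^ α.toReal * tauWeight k n ^ (1 - α.toReal) +
          (1 - p) ^ α.toReal * failWeight k n ^ (1 - α.toReal) := by
      intro n
      rw [flaggedSum, neg_sub, tauWeight_eq, ← Real.rpow_mul zero_le_two, ← Finset.sum_mul,
        mul_assoc, ← Real.rpow_add two_pos]
      congr 3
      ring
    refine ⟨fun x y => x + y, α.toReal - 1, _, (1 - p) ^ α.toReal, isRenyiSum_add, sub_pos.2 hα1,
      hA, hB, Real.rpow_eq_zero (sub_nonneg.2 hp1) (by linarith), fun n hn h => ?_,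
      fun m K hK => ?_⟩
    · have hpos := flaggedSum_pos (e := α.toReal - 1) isRenyiSum_add hA hB hn
      rw [hF] at hpos
      rw [renyiDiv_rhoP_tau_of_ne_top hα htop hσ hp1 hn h hpos, flaggedDiv, hF]
    · have hpos := flaggedSum_pos (e := α.toReal - 1) isRenyiSum_add hA hB (hle m)
      have hS := sum_rpow_pos hsum1 α.toReal
      rw [hF] at hpos
      rw [flaggedDiv, hF]
      have h1 := Real.logb_le_logb_of_le one_lt_two hpos (K.renyiSum_le hρ hρ' hp1 hK hα1)
      have h2 := mul_le_mul_of_nonneg_left h1 (inv_nonneg.2 (sub_nonneg.2 hα1.le))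
      refine h2.trans (le_of_eq ?_)
      rw [Real.logb_mul (by positivity) (by positivity), Real.logb_pow,
        Real.logb_rpow_eq_mul_logb_of_pos (by positivity), Real.logb_inv, Real.logb_pow, logb_two_four,
        renyiEntropy, if_neg htop]
      have h3 : α.toReal - 1 ≠ 0 := by linarith
      have h4 : 1 - α.toReal ≠ 0 := by linarith
      field_simp
      ring

end CSSMagic

theorem mainTheorem2 (k : ℕ) (ρ : Op 1) (hρ : IsRebitState ρ)
    (ρ' : Op k) (hρ' : IsRebitState ρ') (p : ℝ) (hp0 : 0 < p) (hp1 : p ≤ 1)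
    (σ : Op k) (hσ : σ ∈ cssStates k) (α : ℝ≥0∞) (hα : α ∈ orders) :
    (∀ (m : ℕ) (K : CSSCodeProjection k m),
        K.apply (tensorPow ρ (k + m)) = (p : ℂ) • ρ' →
          nLower α ρ ρ' p σ ≤ (((k + m : ℕ) : ℝ) : EReal) ∧
            (((k + m : ℕ) : ℝ) : EReal) ≤ nUpper α ρ ρ' p σ) ∧
      (1 < renyiEntropy α (wigner ρ) → nUpper α ρ ρ' p σ < ⊤) ∧
      (∀ x y a b : ℝ, (k : ℝ) ≤ x → (k : ℝ) ≤ y → 0 ≤ a → 0 ≤ b → a + b = 1 →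
        (a : EReal) * deltaD α ρ ρ' p σ x + (b : EReal) * deltaD α ρ ρ' p σ y ≤
          deltaD α ρ ρ' p σ (a * x + b * y)) ∧
      (p < 1 → Tendsto (deltaD α ρ ρ' p σ) (𝓝[>] (k : ℝ)) (𝓝 ⊥)) ∧
      (1 < renyiEntropy α (wigner ρ) → Tendsto (deltaD α ρ ρ' p σ) atTop (𝓝 ⊥)) := by
  obtain ⟨φ, e, A, B, hφ, he, hA, hB, hBp, hdiv, hK⟩ :=
    exists_flaggedDiv hρ hρ' hp0 hp1 hσ hα
  have hD : ∀ n : ℝ, (k : ℝ) ≤ n → (B = 0 ∨ (k : ℝ) < n) → deltaD α ρ ρ' p σ n =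
      ((n * (2 - renyiEntropy α (wigner ρ)) - flaggedDiv φ k e A B n : ℝ) : EReal) := by
    intro n hn h
    rw [deltaD, renyiDiv_maxMixed hα hρ.1.2, hdiv n hn (h.imp_left hBp.1), ← EReal.coe_mul,
      ← EReal.coe_sub]
  have hDk : B ≠ 0 → deltaD α ρ ρ' p σ k = ⊥ := by
    intro h
    have hp : p < 1 := lt_of_le_of_ne hp1 fun h1 => h (hBp.2 (by rw [h1, sub_self]))
    rw [deltaD, renyiDiv_maxMixed hα hρ.1.2, renyiDiv_rhoP_tau_self hα hσ hp, EReal.sub_top]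
  refine ⟨fun m K h => ?_, fun h => ?_, fun x y a b hx hy ha hb hab => ?_, fun h => ?_, fun h => ?_⟩
  · have hn : (k : ℝ) ≤ (k + m : ℕ) := by exact_mod_cast Nat.le_add_right k m
    have hmem : (((k + m : ℕ) : ℝ) : EReal) ∈ feasible α ρ ρ' p σ := by
      refine ⟨_, ⟨hn, ?_⟩, rfl⟩
      rw [hD _ hn ((K.eq_one_or_lt hρ hρ' h).imp_left hBp.2)]
      exact EReal.coe_nonneg.2 (sub_nonneg.2 (hK m K h))
    exact ⟨sInf_le hmem, le_sSup hmem⟩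
  · exact divDiff_bddAbove hφ he hA hB hD (by linarith)
  · exact divDiff_concave hφ he hA hB hD hDk hx hy ha hb hab
  · refine divDiff_tendsto_nhdsGT hφ he hA hB hD (lt_of_le_of_ne hB fun h0 => ?_)
    linarith [hBp.1 h0.symm]
  · exact divDiff_tendsto_atTop hφ he hA hB hD (by linarith)
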